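/- **Theorem 3.5.** Let $d\ge 1$, let $\Gamma\subset\mathbb R^d$ be a lattice with fundamental cell $\mathcal O$ and determinant $d(\Gamma)=|\mathcal O|$, and let $\Gamma^\dagger=\{\theta:\langle\theta,\gamma\rangle\in 2\pi\mathbb Z\ \forall\gamma\in\Gamma\}$ be its dual lattice. Write $\langle t\rangle=\sqrt{1+|t|^2}$, and denote the Fourier coefficients of a function $u$ on $\mathcal O$ by $\hat u(\theta)=d(\Gamma)^{-1/2}\int_{\mathcal O}e^{-i\langle\theta,x\rangle}u(x)\,dx$, $\theta\in\Gamma^\dagger$. Let $m>0$, $\alpha\in\mathbb R$, $\beta\in(0,1]$, $0<\varkappa<\beta$, and assume $$\beta(\alpha-1)<2m-1 .$$ Let $b(x,\xi)$ be a $\Gamma$-periodic (in $x$) symbol whose Fourier coefficients $\hat b(\theta,\xi)$ in $x$ are smooth in $\xi$ with $$\|b\|_{l,s}:=\max_{|\mathbf s|\le s}\ \sup_{\xi\in\mathbb R^d,\,\theta\in\Gamma^\dagger}\langle\theta\rangle^{l}\,\langle\xi\rangle^{\beta(-\alpha+|\mathbf s|)}\,|D_\xi^{\mathbf s}\hat b(\theta,\xi)|<\infty\qquad\text{for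 all } l\ge0,\ s\in\mathbb Z_{\ge 0},$$ and which is symmetric: $\hat b(\theta,\xi)=\overline{\hat b(-\theta,\xi+\theta)}$. Fix $\iota\in C^\infty(\mathbb R)$ with $0\le\iota\le1$, $\iota(z)=1$ for $z\le 1/4$ and $\iota(z)=0$ for $z\ge1/2$. For $\rho\ge1$ and $1\le r\le\rho^{\varkappa}$ put $$b^o(\xi)=\frac{\hat b(0,\xi)}{\sqrt{d(\Gamma)}},\qquad b^\flat(x,\xi)=\frac1{\sqrt{d(\Gamma)}}\sum_{\theta\in\Gamma^\dagger,\ 0<|\theta|\le r}\hat b(\theta,\xi)\,\iota\Big(\frac{|\langle\theta,\xi+\theta/2\rangle|}{\rho^{\beta}|\theta|}\Big)\,\iota\Big(\Big|\frac{|\xi+\theta/2|}{\rho}-1\Big|\Big)\,e^{i\langle\theta,x\rangle},$$ and let $A=H_0+B^o+B^\flat$ be the operator with symbol $a(x,\xi)=|\xi|^{2m}+b^o(\xi)+b^\flat(x,\xi)$. For $k\in\mathbb R^d$ its fibre $A(k)$ is the operator $$A(k)u(x)=\frac1{\sqrt{d(\Gamma)}}\sum_{n\in\Gamma^\dagger}e^{i\langle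 n,x\rangle}a(x,n+k)\,\hat u(n)$$ in $L^2(\mathcal O)$ with domain the periodic Sobolev space of order $2m$, and $\lambda_1(A(k))\le\lambda_2(A(k))\le\dots$ are its eigenvalues in ascending order, counted with multiplicity. Put $|\eta|_{\mathbb T}=\min_{n\in\Gamma^\dagger}|\eta-n|$. Let $l>d$ and $0<c_1\le c_2$. Consider, for $j\ge1$ and $k,\eta\in\mathbb R^d$ with $$c_1\rho^{2m}\le\lambda_j(A(k))\le c_2\rho^{2m},\tag{1}$$ the estimate $$|\lambda_j(A(k+\eta))-\lambda_j(A(k))|\le C\,(1+\|b\|_{l,1})\,|\eta|_{\mathbb T}\,\rho^{2m-1}.\tag{2}$$ 1. There is a constant $C>0$, depending only on $d,\Gamma,m,\alpha,\beta,\varkappa,\iota,l,c_1,c_2$, such that for each $K$ there is $\rho_0=\rho_0(K)\ge1$ (depending on $K$ and the same data) with the following property: (1) implies (2) for all $b$ as above with $\|b\|_{l,1}\le K$, all $\rho\ge\rho_0$, all $1\le r\le\rho^{\varkappa}$, and all $j$, $k$, $\eta$. 2. If moreover $m\ge\frac12$, then for each $K$ there is a constant $C>0$, depending only on $K$ and the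 same data, such that (1) implies (2) for all $b$ as above with $\|b\|_{l,1}\le K$, all $\rho\ge1$, all $1\le r\le\rho^{\varkappa}$, and all $j$, $k$, $\eta$. -/

import Mathlib

open scoped ContDiff ENNReal
open MeasureTheory

noncomputable section

namespace PeriodicPDO

/-! ### Unbounded operators: eigenvalues in ascending order -/

section Eigenvalues

variable {H : Type*} [NormedAddCommGroup H] [InnerProductSpace ℂ H]

/-- The eigenspace of the (unbounded, partially defined) operator `T` for the real number `μ`. -/
def eigenspace (T : H →ₗ.[ℂ] H) (μ : ℝ) : Submodule ℂ H where
  carrier := {u | ∃ h : u ∈ T.domain, T ⟨u, h⟩ = (μ : ℂ) • u}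
  zero_mem' := ⟨T.domain.zero_mem, by
    have : (⟨0, T.domain.zero_mem⟩ : T.domain) = 0 := rfl
    rw [this, LinearPMap.map_zero, smul_zero]⟩
  add_mem' := by
    rintro u w ⟨hu, hu'⟩ ⟨hw, hw'⟩
    refine ⟨T.domain.add_mem hu hw, ?_⟩
    have : (⟨u + w, T.domain.add_mem hu hw⟩ : T.domain) = ⟨u, hu⟩ + ⟨w, hw⟩ := rfl
    rw [this, LinearPMap.map_add, hu', hw', smul_add]
  smul_mem' := by
    rintro c u ⟨hu, hu'⟩
    refine ⟨T.domain.smul_mem c hu, ?_⟩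
    have : (⟨c • u, T.domain.smul_mem c hu⟩ : T.domain) = c • ⟨u, hu⟩ := rfl
    rw [this, LinearPMap.map_smul, hu', smul_comm]

/-- The counting function: the number of eigenvalues of `T`, with multiplicity, that are `≤ t`. -/
def countingFunction (T : H →ₗ.[ℂ] H) (t : ℝ) : ℕ∞ :=
  Cardinal.toENat (Module.rank ℂ (⨆ μ : Set.Iic t, eigenspace T (μ : ℝ) : Submodule ℂ H))

/-- The `j`-th eigenvalue (`j = 1, 2, …`) of `T`, counted with multiplicity in ascending order:
the least `t` such that at least `j` eigenvalues are `≤ t`. -/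
def eigenvalue (T : H →ₗ.[ℂ] H) (j : ℕ) : ℝ :=
  sInf {t : ℝ | (j : ℕ∞) ≤ countingFunction T t}

end Eigenvalues

/-! ### The lattice, its dual, and Fourier coefficients

The lattice `Γ` is the integer span of a basis `v` of `ℝ^d`. -/

/-- `ℝ^d` with the Euclidean norm. -/
abbrev Space (d : ℕ) : Type := EuclideanSpace ℝ (Fin d)

variable {d : ℕ}

/-- The lattice `Γ` generated by `v`. -/
def lattice (v : Module.Basis (Fin d) ℝ (Space d)) : Submodule ℤ (Space d) :=
  Submodule.span ℤ (Set.range v)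

/-- The dual lattice `Γ† = {θ : ⟨θ, γ⟩ ∈ 2πℤ for all γ ∈ Γ}`. -/
def dualLattice (v : Module.Basis (Fin d) ℝ (Space d)) : AddSubgroup (Space d) where
  carrier := {θ | ∀ γ ∈ lattice v, ∃ n : ℤ, inner ℝ θ γ = 2 * Real.pi * n}
  zero_mem' := fun γ _ => ⟨0, by simp⟩
  add_mem' := by
    intro a b ha hb γ hγ
    obtain ⟨p, hp⟩ := ha γ hγ
    obtain ⟨q, hq⟩ := hb γ hγ
    exact ⟨p + q, by rw [inner_add_left, hp, hq]; push_cast; ring⟩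
  neg_mem' := by
    intro a ha γ hγ
    obtain ⟨p, hp⟩ := ha γ hγ
    exact ⟨-p, by rw [inner_neg_left, hp]; push_cast; ring⟩

/-- The fundamental cell `𝒪` of `Γ`: the half-open parallelepiped spanned by `v`. -/
def cell (v : Module.Basis (Fin d) ℝ (Space d)) : Set (Space d) := ZSpan.fundamentalDomain v

/-- The determinant `d(Γ)` of the lattice, i.e. the volume of the cell. -/
def latticeDet (v : Module.Basis (Fin d) ℝ (Space d)) : ℝ := volume.real (cell v)

/-- Lebesgue measure on the cell. -/
def cellMeasure (v : Module.Basis (Fin d) ℝ (Space d)) : Measure (Space d) :=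
  volume.restrict (cell v)

/-- The fibre Hilbert space `L²(𝒪)`. -/
abbrev FibreSpace (v : Module.Basis (Fin d) ℝ (Space d)) : Type := Lp ℂ 2 (cellMeasure v)

/-- The exponential `e^{i⟨θ, x⟩}`. -/
def expo (θ x : Space d) : ℂ := Complex.exp (Complex.I * (inner ℝ θ x : ℝ))

/-- The Fourier coefficient `û(θ) = d(Γ)^{-1/2} ∫_𝒪 e^{-i⟨θ, x⟩} u(x) dx`. -/
def cellCoeff (v : Module.Basis (Fin d) ℝ (Space d)) (u : Space d → ℂ) (θ : Space d) : ℂ :=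
  ((Real.sqrt (latticeDet v) : ℝ) : ℂ)⁻¹ * ∫ x in cell v, expo (-θ) x * u x

/-- The Fourier coefficient `b̂(θ, ξ)` of a symbol `b(x, ξ)` in the variable `x`. -/
def symbolCoeff (v : Module.Basis (Fin d) ℝ (Space d)) (b : Space d → Space d → ℂ)
    (θ ξ : Space d) : ℂ :=
  cellCoeff v (fun x => b x ξ) θ

/-- The distance on the torus, `|η|_𝕋 = min_{n ∈ Γ†} |η - n|`. -/
def torusDist (v : Module.Basis (Fin d) ℝ (Space d)) (η : Space d) : ℝ :=
  Metric.infDist η (dualLattice v : Set (Space d))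

/-! ### Symbol classes -/

/-- `⟨t⟩ = √(1 + |t|²)`. -/
def japanese (t : Space d) : ℝ := Real.sqrt (1 + ‖t‖ ^ 2)

/-- The partial derivative `∂_{σ 0} ⋯ ∂_{σ (n-1)} f (ξ)` in the standard coordinates of `ℝ^d`. -/
def partialDeriv (f : Space d → ℂ) {n : ℕ} (σ : Fin n → Fin d) (ξ : Space d) : ℂ :=
  iteratedFDeriv ℝ n f ξ (fun i => EuclideanSpace.single (σ i) (1 : ℝ))

/-- The symbol norm, with values in `[0, ∞]`: the supremum over all partial derivatives in `ξ` of
order `n ≤ s`, over `ξ ∈ ℝ^d` and `θ ∈ Γ†`, of `⟨θ⟩^l w(ξ)^{-α+n} |∂_ξ^{(n)} b̂(θ, ξ)|`. -/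
def symbolENorm (v : Module.Basis (Fin d) ℝ (Space d)) (w : Space d → ℝ) (α l : ℝ) (s : ℕ)
    (b : Space d → Space d → ℂ) : ℝ≥0∞ :=
  ⨆ (n : ℕ) (_ : n ≤ s) (σ : Fin n → Fin d) (ξ : Space d) (θ : dualLattice v),
    ENNReal.ofReal (japanese (θ : Space d) ^ l * w ξ ^ (-α + n) *
      ‖partialDeriv (symbolCoeff v b θ) σ ξ‖)

/-- The symbol norm as a real number; it is meaningful where `symbolENorm` is finite. -/
def symbolNorm (v : Module.Basis (Fin d) ℝ (Space d)) (w : Space d → ℝ) (α l : ℝ) (s : ℕ)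
    (b : Space d → Space d → ℂ) : ℝ :=
  (symbolENorm v w α l s b).toReal

/-- The class of `Γ`-periodic symbols of order `α` with respect to the weight `w`. -/
structure IsSymbol (v : Module.Basis (Fin d) ℝ (Space d)) (w : Space d → ℝ) (α : ℝ)
    (b : Space d → Space d → ℂ) : Prop where
  periodic : ∀ γ ∈ lattice v, ∀ x ξ, b (x + γ) ξ = b x ξ
  integrable : ∀ ξ, IntegrableOn (fun x => b x ξ) (cell v)
  smooth : ∀ θ ∈ dualLattice v, ContDiff ℝ ∞ (symbolCoeff v b θ)
  norm_lt_top : ∀ l : ℝ, 0 ≤ l → ∀ s : ℕ, symbolENorm v w α l s b < ⊤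

/-- Symmetric symbols: `b̂(θ, ξ)` is the complex conjugate of `b̂(-θ, ξ + θ)`. -/
def IsSymmetricSymbol (v : Module.Basis (Fin d) ℝ (Space d)) (b : Space d → Space d → ℂ) : Prop :=
  ∀ θ ∈ dualLattice v, ∀ ξ, symbolCoeff v b θ ξ = star (symbolCoeff v b (-θ) (ξ + θ))

/-- The weight `⟨ξ⟩^β`. -/
def weight (β : ℝ) (ξ : Space d) : ℝ := japanese ξ ^ β

/-! ### The parts `b^o` and `b^♭` of a symbol -/

/-- A smooth cut-off `ι : ℝ → [0, 1]`, equal to `1` on `z ≤ 1/4` and to `0` on `z ≥ 1/2`. -/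
structure IsCutoff (ι : ℝ → ℝ) : Prop where
  smooth : ContDiff ℝ ∞ ι
  nonneg : ∀ z, 0 ≤ ι z
  le_one : ∀ z, ι z ≤ 1
  eq_one : ∀ z, z ≤ 1 / 4 → ι z = 1
  eq_zero : ∀ z, 1 / 2 ≤ z → ι z = 0

/-- The energy cut-off `e_θ(ξ) = ι(| |ξ + θ/2| / ρ - 1 |)`. -/
def energyCutoff (ι : ℝ → ℝ) (ρ : ℝ) (θ ξ : Space d) : ℝ :=
  ι |‖ξ + (1 / 2 : ℝ) • θ‖ / ρ - 1|

/-- The resonance cut-off `ζ_θ(ξ; L) = ι(|⟨θ, ξ + θ/2⟩| / (L |θ|))`. -/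
def resonanceCutoff (ι : ℝ → ℝ) (L : ℝ) (θ ξ : Space d) : ℝ :=
  ι (|inner ℝ θ (ξ + (1 / 2 : ℝ) • θ)| / (L * ‖θ‖))

/-- `Θ_r = {θ ∈ Γ† : 0 < |θ| ≤ r}`. -/
def frequencySet (v : Module.Basis (Fin d) ℝ (Space d)) (r : ℝ) : Set (Space d) :=
  {θ | θ ∈ dualLattice v ∧ 0 < ‖θ‖ ∧ ‖θ‖ ≤ r}

theorem frequencySet_finite (v : Module.Basis (Fin d) ℝ (Space d)) (r : ℝ) :
    (frequencySet v r).Finite := by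
  obtain ⟨M, hM⟩ : ∃ M : ℤ, ∀ i, r * ‖v i‖ ≤ 2 * Real.pi * M := by
    obtain ⟨B, hB⟩ := (Set.finite_range fun i => r * ‖v i‖).bddAbove
    obtain ⟨M, hM⟩ := exists_int_gt (B / (2 * Real.pi))
    refine ⟨M, fun i => (hB ⟨i, rfl⟩).trans ?_⟩
    rw [div_lt_iff₀ (by positivity)] at hM
    linarith
  let g : Space d → Fin d → ℝ := fun θ i => inner ℝ θ (v i)
  have hg : Set.InjOn g (frequencySet v r) := by
    intro a _ b _ hab
    have h0 : innerₛₗ ℝ a = innerₛₗ ℝ b := v.ext fun i => congrFun hab i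
    exact ext_inner_right ℝ fun x => LinearMap.congr_fun h0 x
  refine Set.Finite.of_finite_image ?_ hg
  refine ((Set.finite_Icc (fun _ : Fin d => -M) (fun _ => M)).image
    (fun n i => 2 * Real.pi * (n i : ℝ))).subset ?_
  rintro _ ⟨θ, ⟨hθ, _, hr⟩, rfl⟩
  choose n hn using fun i => hθ (v i) (Submodule.subset_span ⟨i, rfl⟩)
  have hb : ∀ i, |(n i : ℝ)| ≤ M := by
    intro i
    have h1 : |inner ℝ θ (v i)| ≤ r * ‖v i‖ :=
      (abs_real_inner_le_norm θ (v i)).trans (by gcongr)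
    rw [hn i, abs_mul, abs_of_pos Real.two_pi_pos] at h1
    exact le_of_mul_le_mul_left (h1.trans (hM i)) Real.two_pi_pos
  refine ⟨n, ⟨fun i => ?_, fun i => ?_⟩, ?_⟩
  · have := (abs_le.1 (hb i)).1
    exact_mod_cast this
  · have := (abs_le.1 (hb i)).2
    exact_mod_cast this
  · funext i
    exact (hn i).symm

/-- `b^o(ξ) = d(Γ)^{-1/2} b̂(0, ξ)`. -/
def symbolO (v : Module.Basis (Fin d) ℝ (Space d)) (b : Space d → Space d → ℂ)
    (ξ : Space d) : ℂ :=
  ((Real.sqrt (latticeDet v) : ℝ) : ℂ)⁻¹ * symbolCoeff v b 0 ξ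

/-- The resonant part
`b^♭(x, ξ; ρ) = d(Γ)^{-1/2} ∑_{θ ∈ Θ_r} b̂(θ, ξ) ζ_θ(ξ; ρ^β) e_θ(ξ) e^{i⟨θ, x⟩}`. -/
def symbolFlat (v : Module.Basis (Fin d) ℝ (Space d)) (β : ℝ) (ι : ℝ → ℝ) (ρ r : ℝ)
    (b : Space d → Space d → ℂ) (x ξ : Space d) : ℂ :=
  ((Real.sqrt (latticeDet v) : ℝ) : ℂ)⁻¹ * ∑ θ ∈ (frequencySet_finite v r).toFinset,
    symbolCoeff v b θ ξ * (resonanceCutoff ι (ρ ^ β) θ ξ : ℂ) * (energyCutoff ι ρ θ ξ : ℂ) *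
      expo θ x

/-- The symbol `|ξ|^{2m} + b^o(ξ) + b^♭(x, ξ)` of `A = H₀ + B^o + B^♭`. -/
def modelSymbol (v : Module.Basis (Fin d) ℝ (Space d)) (m β : ℝ) (ι : ℝ → ℝ) (ρ r : ℝ)
    (b : Space d → Space d → ℂ) (x ξ : Space d) : ℂ :=
  ((‖ξ‖ ^ (2 * m) : ℝ) : ℂ) + symbolO v b ξ + symbolFlat v β ι ρ r b x ξ

theorem continuous_expo (θ : Space d) : Continuous (expo θ) := by
  unfold expo
  fun_prop

theorem norm_expo (θ x : Space d) : ‖expo θ x‖ = 1 := by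
  rw [expo, mul_comm, Complex.norm_exp_ofReal_mul_I]

theorem continuous_modelSymbol (v : Module.Basis (Fin d) ℝ (Space d)) (m β : ℝ) (ι : ℝ → ℝ)
    (ρ r : ℝ) (b : Space d → Space d → ℂ) (ξ : Space d) :
    Continuous fun x => modelSymbol v m β ι ρ r b x ξ := by
  unfold modelSymbol symbolFlat
  refine continuous_const.add (continuous_const.mul (continuous_finsetSum _ fun θ _ => ?_))
  exact continuous_const.mul (continuous_expo θ)

/-! ### Fibres of periodic pseudo-differential operators -/

/-- The function `x ↦ d(Γ)^{-1/2} e^{i⟨n, x⟩} a(x, n + k)`. -/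
def fibreFun (v : Module.Basis (Fin d) ℝ (Space d)) (a : Space d → Space d → ℂ) (k n x : Space d) :
    ℂ :=
  ((Real.sqrt (latticeDet v) : ℝ) : ℂ)⁻¹ * (expo n x * a x (n + k))

theorem memLp_fibreFun (v : Module.Basis (Fin d) ℝ (Space d)) (a : Space d → Space d → ℂ)
    (ha : ∀ ξ, Continuous fun x => a x ξ) (k n : Space d) :
    MemLp (fibreFun v a k n) 2 (cellMeasure v) := by
  have hcont : Continuous (fibreFun v a k n) := by
    unfold fibreFun
    exact continuous_const.mul ((continuous_expo n).mul (ha _))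
  have hbd : Bornology.IsBounded (cell v) := ZSpan.fundamentalDomain_isBounded v
  have hfin : IsFiniteMeasure (cellMeasure v) :=
    ⟨by rw [cellMeasure, Measure.restrict_apply_univ]; exact hbd.measure_lt_top⟩
  obtain ⟨C, hC⟩ := hbd.isCompact_closure.exists_bound_of_continuousOn hcont.continuousOn
  refine MemLp.of_bound hcont.aestronglyMeasurable C ?_
  rw [cellMeasure]
  exact ae_restrict_of_forall_mem (ZSpan.fundamentalDomain_measurableSet v)
    fun x hx => hC x (subset_closure hx)

/-- The element of `L²(𝒪)` given by `x ↦ d(Γ)^{-1/2} e^{i⟨n, x⟩} a(x, n + k)`. -/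
def fibreTerm (v : Module.Basis (Fin d) ℝ (Space d)) (a : Space d → Space d → ℂ)
    (ha : ∀ ξ, Continuous fun x => a x ξ) (k n : Space d) : FibreSpace v :=
  (memLp_fibreFun v a ha k n).toLp (fibreFun v a k n)

/-- The Fourier coefficient as a linear functional on `L²(𝒪)`. -/
def coeffL (v : Module.Basis (Fin d) ℝ (Space d)) (θ : Space d) : FibreSpace v →ₗ[ℂ] ℂ where
  toFun u := cellCoeff v u θ
  map_add' := by
    intro u w
    have hfin : IsFiniteMeasure (cellMeasure v) :=
      ⟨by rw [cellMeasure, Measure.restrict_apply_univ]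
          exact (ZSpan.fundamentalDomain_isBounded v).measure_lt_top⟩
    have hint : ∀ f : FibreSpace v, Integrable (fun x => expo (-θ) x * f x) (cellMeasure v) := by
      intro f
      refine ((Lp.memLp f).integrable (by norm_num)).bdd_mul (c := 1)
        (continuous_expo (-θ)).aestronglyMeasurable ?_
      exact Filter.Eventually.of_forall fun x => (norm_expo (-θ) x).le
    have h : ∫ x in cell v, expo (-θ) x * (u + w : FibreSpace v) x =
        (∫ x in cell v, expo (-θ) x * u x) + ∫ x in cell v, expo (-θ) x * w x := by
      refine Eq.trans ?_ (integral_add (hint u) (hint w))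
      refine integral_congr_ae ?_
      filter_upwards [Lp.coeFn_add u w] with x hx
      rw [hx, Pi.add_apply, mul_add]
    simp only [cellCoeff]
    rw [h, mul_add]
  map_smul' := by
    intro c u
    have h : ∫ x in cell v, expo (-θ) x * (c • u : FibreSpace v) x =
        c * ∫ x in cell v, expo (-θ) x * u x := by
      rw [← integral_const_mul]
      refine integral_congr_ae ?_
      filter_upwards [Lp.coeFn_smul c u] with x hx
      rw [hx, Pi.smul_apply, smul_eq_mul]
      ring
    simp only [cellCoeff, RingHom.id_apply, smul_eq_mul]
    rw [h]
    ring

/-- Membership in the periodic Sobolev space of order `s`: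
`∑_{n ∈ Γ†} ⟨n⟩^{2s} |û(n)|² < ∞`. -/
def InSobolev (v : Module.Basis (Fin d) ℝ (Space d)) (s : ℝ) (u : FibreSpace v) : Prop :=
  Summable fun n : dualLattice v => japanese (n : Space d) ^ (2 * s) * ‖coeffL v n u‖ ^ 2

theorem InSobolev.zero (v : Module.Basis (Fin d) ℝ (Space d)) (s : ℝ) :
    InSobolev v s (0 : FibreSpace v) := by
  simp only [InSobolev, map_zero, norm_zero]
  simp [summable_zero]

theorem InSobolev.add {v : Module.Basis (Fin d) ℝ (Space d)} {s : ℝ} {u w : FibreSpace v}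
    (hu : InSobolev v s u) (hw : InSobolev v s w) : InSobolev v s (u + w) := by
  refine Summable.of_nonneg_of_le (fun n => ?_) (fun n => ?_) ((Summable.add hu hw).mul_left 2)
  · exact mul_nonneg (Real.rpow_nonneg (Real.sqrt_nonneg _) _) (sq_nonneg _)
  · rw [map_add]
    have h0 : 0 ≤ japanese (n : Space d) ^ (2 * s) := Real.rpow_nonneg (Real.sqrt_nonneg _) _
    have h1 : ‖coeffL v n u + coeffL v n w‖ ^ 2 ≤
        2 * (‖coeffL v n u‖ ^ 2 + ‖coeffL v n w‖ ^ 2) := by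
      have := norm_add_le (coeffL v n u) (coeffL v n w)
      nlinarith [sq_nonneg (‖coeffL v n u‖ - ‖coeffL v n w‖),
        norm_nonneg (coeffL v n u + coeffL v n w)]
    nlinarith [mul_le_mul_of_nonneg_left h1 h0]

theorem InSobolev.smul {v : Module.Basis (Fin d) ℝ (Space d)} {s : ℝ} {u : FibreSpace v}
    (c : ℂ) (hu : InSobolev v s u) : InSobolev v s (c • u) := by
  refine (Summable.mul_left (‖c‖ ^ 2) hu).congr fun n => ?_
  rw [map_smul, smul_eq_mul, norm_mul]
  ring

/-- The fibre at quasi-momentum `k` of the periodic pseudo-differential operator with symbol `a`: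
the operator `u ↦ d(Γ)^{-1/2} ∑_{n ∈ Γ†} e^{i⟨n, x⟩} a(x, n + k) û(n)` in `L²(𝒪)`, where the series
converges in `L²(𝒪)`. Its domain consists of the `u` in the periodic Sobolev space of order `s` for
which the series converges. (For `H₀ + B^o + B^♭`, of order `s = 2m > αβ`, the series converges for
all `u` in the Sobolev space, so that the domain is the Sobolev space of order `2m`.) -/
def fibre (v : Module.Basis (Fin d) ℝ (Space d)) (s : ℝ) (a : Space d → Space d → ℂ)
    (ha : ∀ ξ, Continuous fun x => a x ξ) (k : Space d) : FibreSpace v →ₗ.[ℂ] FibreSpace v where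
  domain :=
    { carrier := {u | InSobolev v s u ∧
        Summable fun n : dualLattice v => coeffL v n u • fibreTerm v a ha k n}
      zero_mem' := ⟨InSobolev.zero v s, by simp [summable_zero]⟩
      add_mem' := fun {u w} hu hw => ⟨InSobolev.add hu.1 hw.1, by
        simpa only [map_add, add_smul] using hu.2.add hw.2⟩
      smul_mem' := fun c u hu => ⟨InSobolev.smul c hu.1, by
        simpa only [map_smul, smul_assoc] using hu.2.const_smul c⟩ }
  toFun :=
    { toFun := fun u => ∑' n : dualLattice v, coeffL v n u.1 • fibreTerm v a ha k n
      map_add' := fun u w => by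
        simpa only [Submodule.coe_add, map_add, add_smul] using u.2.2.tsum_add w.2.2
      map_smul' := fun c u => by
        simpa only [Submodule.coe_smul, map_smul, smul_assoc, RingHom.id_apply] using u.2.2.tsum_const_smul c }

/-- The fibre `A(k)` of the operator `A = H₀ + B^o + B^♭`, `H₀ = (-Δ)^m`. -/
def modelFibre (v : Module.Basis (Fin d) ℝ (Space d)) (m β : ℝ) (ι : ℝ → ℝ) (ρ r : ℝ)
    (b : Space d → Space d → ℂ) (k : Space d) : FibreSpace v →ₗ.[ℂ] FibreSpace v :=
  fibre v (2 * m) (modelSymbol v m β ι ρ r b) (continuous_modelSymbol v m β ι ρ r b) k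

/-- The `j`-th Floquet eigenvalue `λ_j(A(k))`, `j = 1, 2, …`. -/
def floquetEigenvalue (v : Module.Basis (Fin d) ℝ (Space d)) (m β : ℝ) (ι : ℝ → ℝ) (ρ r : ℝ)
    (b : Space d → Space d → ℂ) (j : ℕ) (k : Space d) : ℝ :=
  eigenvalue (modelFibre v m β ι ρ r b k) j

end PeriodicPDO

end

open PeriodicPDO

/-!
The proof compares counting functions. Let `N(k, t)` be the number of eigenvalues `≤ t` of `A(k)`,
and let `h(ξ) = |ξ|^{2m} + b^o(ξ)`.

In the basis of normalized exponentials `e_n`, `n ∈ Γ†` (orthonormal and complete in `L²(𝒪)`: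
`coeffL_expoLp`, `eq_zero_of_coeffL_eq_zero`), the fibre `A(k)` is the infinite Hermitian matrix
with entries `c(n' - n, n + k)`, where `c = modelCoeff` collects the Fourier coefficients of the
symbol. The cut-offs make every off-diagonal entry vanish unless both `|n + k|` and `|n' + k|` are
at most `2ρ`. Hence, if `h(ξ) > t` for `|ξ| > Rρ`, the eigenvalues `≤ t` are those of the finite
block with indices `|n + k| ≤ Rρ` (`IsTrigSymbol.countingFunction_le`,
`IsTrigSymbol.le_countingFunction`; the latter also absorbs shifts of `k` by the dual lattice, under
which the matrix is merely reindexed).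

Two such blocks, at `k` and at `k + η`, are compared by the variational principle
(`finrank_lowSpace_le_of_form_le`). The entries at a fixed difference `θ = n' - n` are Lipschitz in
the quasi-momentum with constant `O((1 + ‖b‖) ⟨θ⟩^{-l} ρ^{2m-1})`: off the diagonal both `|ξ| ~ ρ`
and the gain `ρ^{-β}` from differentiating the cut-offs produce `ρ^{β(α-1)} ≤ ρ^{2m-1}`
(`exists_norm_modelCoeff_sub_le`), and on the diagonal one uses `|ξ| ≤ Rρ`
(`exists_norm_modelCoeff_zero_sub_le`). Since `l > d`, Schur's test (`re_inner_le_add_of_schur`)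
bounds the difference of the quadratic forms by `δ = O((1 + ‖b‖) |η| ρ^{2m-1})`, so that
`N(k, t) ≤ N(k + η, t + δ)` (`exists_countingFunction_le`).

On the diagonal the Lipschitz bound fails for small `|ξ|` when `m < 1/2`. In the first assertion the
modes with `|n + k| < ερ` are therefore split off: for large `ρ` they are decoupled from all others,
and their energies stay below the window `[c₁ρ^{2m}/2, 2c₂ρ^{2m})`, so that they contribute equally
to both counting functions; here `R` can be chosen independently of `K`. In the second assertion no
modes are split off, but `R` has to depend on `K`, in order that the kinetic energy dominates `b^o`
for `|ξ| > Rρ` also when `ρ` is close to `1`.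

The inequality of counting functions and its mirror image with the roles of `k` and `k + η`
exchanged give the bound for the eigenvalues (`abs_eigenvalue_sub_le`). Both are needed only for `t`
in the window: if the moved eigenvalue leaves the window upwards, its lower bound is trivial.
-/

namespace PeriodicPDO

/-! ### Counting eigenvalues of symmetric operators in finite dimension -/

section FiniteDimensional

variable {E : Type*} [NormedAddCommGroup E] [InnerProductSpace ℂ E]

/-- The span of the eigenvectors of `τ` belonging to real eigenvalues `≤ t`. -/
def lowSpace (τ : E →ₗ[ℂ] E) (t : ℝ) : Submodule ℂ E :=
  ⨆ μ : Set.Iic t, Module.End.eigenspace τ (((μ : ℝ) : ℂ))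

variable [FiniteDimensional ℂ E]

theorem re_inner_eq_sum_eigenvalues {τ : E →ₗ[ℂ] E} (hτ : τ.IsSymmetric) (x : E) :
    (inner ℂ x (τ x)).re = ∑ i, hτ.eigenvalues rfl i *
      ‖(hτ.eigenvectorBasis rfl).repr x i‖ ^ 2 := by
  rw [← (hτ.eigenvectorBasis rfl).sum_inner_mul_inner x (τ x), Complex.re_sum]
  refine Finset.sum_congr rfl fun i _ => ?_
  have h1 := hτ.eigenvectorBasis_apply_self_apply rfl x i
  have h2 : inner ℂ x ((hτ.eigenvectorBasis rfl) i) =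
      (starRingEnd ℂ) ((hτ.eigenvectorBasis rfl).repr x i) := by
    rw [OrthonormalBasis.repr_apply_apply, inner_conj_symm]
  rw [← OrthonormalBasis.repr_apply_apply, h1, h2, mul_left_comm, mul_comm ((starRingEnd ℂ) _),
    Complex.mul_conj, Complex.normSq_eq_norm_sq]
  exact (Complex.re_ofReal_mul _ _).trans (by rw [Complex.ofReal_re]; rfl)

theorem norm_sq_eq_sum_eigenvectorBasis {τ : E →ₗ[ℂ] E} (hτ : τ.IsSymmetric) (x : E) :
    ‖x‖ ^ 2 = ∑ i, ‖(hτ.eigenvectorBasis rfl).repr x i‖ ^ 2 := by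
  rw [← (hτ.eigenvectorBasis rfl).repr.norm_map x, EuclideanSpace.norm_sq_eq]

theorem repr_eq_zero_of_mem_lowSpace {τ : E →ₗ[ℂ] E} (hτ : τ.IsSymmetric) {t : ℝ} {x : E}
    (hx : x ∈ lowSpace τ t) {i : Fin (Module.finrank ℂ E)} (hi : t < hτ.eigenvalues rfl i) :
    (hτ.eigenvectorBasis rfl).repr x i = 0 := by
  induction hx using Submodule.iSup_induction' with
  | mem μ y hy =>
    rw [Module.End.mem_eigenspace_iff] at hy
    have h1 := hτ.eigenvectorBasis_apply_self_apply rfl y i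
    rw [hy, map_smul, PiLp.smul_apply, smul_eq_mul, ← sub_eq_zero, ← sub_mul] at h1
    refine (mul_eq_zero.1 h1).resolve_left fun h => ?_
    have h2 : (μ : ℝ) = hτ.eigenvalues rfl i := by
      rw [sub_eq_zero] at h
      exact Complex.ofReal_injective h
    have := μ.2
    rw [Set.mem_Iic, h2] at this
    exact absurd hi this.not_gt
  | zero => simp
  | add y z _ _ hy hz => rw [map_add, PiLp.add_apply, hy, hz, add_zero]

/-- On the low-energy space the quadratic form is bounded by the energy. -/
theorem re_inner_le_of_mem_lowSpace {τ : E →ₗ[ℂ] E} (hτ : τ.IsSymmetric) {t : ℝ} {x : E}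
    (hx : x ∈ lowSpace τ t) : (inner ℂ x (τ x)).re ≤ t * ‖x‖ ^ 2 := by
  rw [re_inner_eq_sum_eigenvalues hτ, norm_sq_eq_sum_eigenvectorBasis hτ, Finset.mul_sum]
  refine Finset.sum_le_sum fun i _ => ?_
  rcases le_or_gt (hτ.eigenvalues rfl i) t with h | h
  · gcongr
  · rw [repr_eq_zero_of_mem_lowSpace hτ hx h]
    simp

/-- On nonzero vectors orthogonal to the low-energy space the form strictly exceeds `t ‖x‖²`. -/
theorem eq_zero_of_inner_lowSpace_eq_zero {τ : E →ₗ[ℂ] E} (hτ : τ.IsSymmetric) {t : ℝ} {x : E}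
    (hx : ∀ y ∈ lowSpace τ t, inner ℂ y x = 0) (hle : (inner ℂ x (τ x)).re ≤ t * ‖x‖ ^ 2) :
    x = 0 := by
  have hlow : ∀ i, hτ.eigenvalues rfl i ≤ t → (hτ.eigenvectorBasis rfl).repr x i = 0 := by
    intro i hi
    rw [OrthonormalBasis.repr_apply_apply]
    refine hx _ (Submodule.mem_iSup_of_mem ⟨hτ.eigenvalues rfl i, hi⟩ ?_)
    rw [Module.End.mem_eigenspace_iff]
    exact hτ.apply_eigenvectorBasis rfl i
  rw [re_inner_eq_sum_eigenvalues hτ, norm_sq_eq_sum_eigenvectorBasis hτ, Finset.mul_sum,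
    ← sub_nonpos, ← Finset.sum_sub_distrib] at hle
  have hnn : ∀ i ∈ Finset.univ, 0 ≤ hτ.eigenvalues rfl i *
      ‖(hτ.eigenvectorBasis rfl).repr x i‖ ^ 2 - t * ‖(hτ.eigenvectorBasis rfl).repr x i‖ ^ 2 := by
    intro i _
    rcases le_or_gt (hτ.eigenvalues rfl i) t with h | h
    · simp [hlow i h]
    · rw [← sub_mul]
      exact mul_nonneg (sub_nonneg.2 h.le) (sq_nonneg _)
  have h0 := (Finset.sum_eq_zero_iff_of_nonneg hnn).1 (le_antisymm hle (Finset.sum_nonneg hnn))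
  refine (hτ.eigenvectorBasis rfl).repr.map_eq_zero_iff.1 ?_
  ext i
  rcases le_or_gt (hτ.eigenvalues rfl i) t with h | h
  · simp [hlow i h]
  · have h1 := h0 i (Finset.mem_univ i)
    rw [← sub_mul, mul_eq_zero] at h1
    simpa using h1.resolve_left (sub_pos.2 h).ne'

/-- The variational principle: the low-energy space is at least as large as any subspace on which
the quadratic form is bounded by the energy. -/
theorem finrank_le_finrank_lowSpace {τ : E →ₗ[ℂ] E} (hτ : τ.IsSymmetric) {t : ℝ}
    (V : Submodule ℂ E) (hV : ∀ x ∈ V, (inner ℂ x (τ x)).re ≤ t * ‖x‖ ^ 2) :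
    Module.finrank ℂ V ≤ Module.finrank ℂ (lowSpace τ t) := by
  have hdisj : Disjoint V (lowSpace τ t)ᗮ := by
    rw [Submodule.disjoint_def]
    intro x hxV hx
    exact eq_zero_of_inner_lowSpace_eq_zero hτ (fun y hy => (Submodule.mem_orthogonal _ _).1 hx y hy)
      (hV x hxV)
  have h1 := Submodule.finrank_add_finrank_le_of_disjoint hdisj
  have h2 := (lowSpace τ t).finrank_add_finrank_orthogonal
  omega

end FiniteDimensional

/-! ### Comparison of two Hermitian matrices -/

section Matrices

variable {I : Type*} [Fintype I]

/-- The part of `x` supported in `s`. -/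
def restrictTo (s : Set I) [DecidablePred (· ∈ s)] (x : EuclideanSpace ℂ I) : EuclideanSpace ℂ I :=
  WithLp.toLp 2 fun i => if i ∈ s then x i else 0

theorem inner_toEuclideanLin [DecidableEq I] (M : Matrix I I ℂ) (x : EuclideanSpace ℂ I) :
    inner ℂ x (M.toEuclideanLin x) = ∑ i, ∑ j, star (x i) * M i j * x j := by
  rw [PiLp.inner_apply]
  refine Finset.sum_congr rfl fun i _ => ?_
  simp only [Matrix.toLpLin_apply, Matrix.mulVec, dotProduct, RCLike.inner_apply, Finset.sum_mul]
  refine Finset.sum_congr rfl fun j _ => ?_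
  simp only [starRingEnd_apply]
  ring

/-- If `s` is a set of indices at which `M` is diagonal, restricting to the complement of `s` maps
the low-energy space of `M` into itself. -/
theorem restrictTo_compl_mem_lowSpace [DecidableEq I] {M : Matrix I I ℂ} {s : Set I}
    [DecidablePred (· ∈ s)]
    (hs : ∀ i ∈ s, ∀ j, j ≠ i → M i j = 0 ∧ M j i = 0) {t : ℝ} {x : EuclideanSpace ℂ I}
    (hx : x ∈ lowSpace M.toEuclideanLin t) : restrictTo sᶜ x ∈ lowSpace M.toEuclideanLin t := by
  induction hx using Submodule.iSup_induction' with
  | mem μ y hy =>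
    refine Submodule.mem_iSup_of_mem μ ?_
    rw [Module.End.mem_eigenspace_iff] at hy ⊢
    ext i
    have hy' : ∀ i, ∑ j, M i j * y j = (μ : ℝ) * y i := by
      intro i
      have := congrArg (fun z : EuclideanSpace ℂ I => z i) hy
      simpa [Matrix.toLpLin_apply, Matrix.mulVec, dotProduct] using this
    simp only [restrictTo, Matrix.toLpLin_apply, Matrix.mulVec, dotProduct, PiLp.smul_apply,
      smul_eq_mul]
    by_cases hi : i ∈ s
    · simp only [Set.mem_compl_iff, hi, not_true_eq_false, if_false, mul_zero]
      refine Finset.sum_eq_zero fun j _ => ?_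
      by_cases hj : j ∈ s
      · simp [hj]
      · rw [((hs i hi) j (by rintro rfl; exact hj hi)).1, zero_mul]
    · simp only [Set.mem_compl_iff, hi, not_false_eq_true, if_true]
      rw [← hy' i]
      refine Finset.sum_congr rfl fun j _ => ?_
      by_cases hj : j ∈ s
      · rw [((hs j hj) i (by rintro rfl; exact hi hj)).2]
        simp
      · simp [hj]
  | zero =>
    have : restrictTo sᶜ (0 : EuclideanSpace ℂ I) = 0 := by ext i; simp [restrictTo]
    rw [this]
    exact zero_mem _
  | add y z _ _ hy hz =>
    have : restrictTo sᶜ (y + z) = restrictTo sᶜ y + restrictTo sᶜ z := by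
      ext i
      simp only [restrictTo, PiLp.add_apply]
      split_ifs <;> simp
    rw [this]
    exact add_mem hy hz

/-- The quadratic form of a matrix that is diagonal at the indices in `s` splits. -/
theorem re_inner_eq_restrictTo_add [DecidableEq I] {M : Matrix I I ℂ} {s : Set I} [DecidablePred (· ∈ s)]
    (hs : ∀ i ∈ s, ∀ j, j ≠ i → M i j = 0 ∧ M j i = 0) (x : EuclideanSpace ℂ I) :
    (inner ℂ x (M.toEuclideanLin x)).re =
      (∑ i, if i ∈ s then (M i i).re * ‖x i‖ ^ 2 else 0) +
        (inner ℂ (restrictTo sᶜ x) (M.toEuclideanLin (restrictTo sᶜ x))).re := by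
  rw [inner_toEuclideanLin, inner_toEuclideanLin, Complex.re_sum, Complex.re_sum,
    ← Finset.sum_add_distrib]
  refine Finset.sum_congr rfl fun i _ => ?_
  by_cases hi : i ∈ s
  · rw [Finset.sum_eq_single i (fun j _ hj => by rw [((hs i hi) j hj).1]; ring) (by simp)]
    simp only [restrictTo, Set.mem_compl_iff, hi, not_true_eq_false, if_false, if_true, star_zero,
      zero_mul, Finset.sum_const_zero, Complex.zero_re, add_zero]
    rw [mul_assoc, mul_left_comm, mul_comm (star _), ← starRingEnd_apply, Complex.mul_conj,
      Complex.normSq_eq_norm_sq, Complex.re_mul_ofReal]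
  · simp only [hi, if_false, zero_add]
    congr 1
    refine Finset.sum_congr rfl fun j _ => ?_
    by_cases hj : j ∈ s
    · rw [((hs j hj) i (by rintro rfl; exact hi hj)).2]
      simp
    · simp [restrictTo, hi, hj]

theorem norm_sq_eq_restrictTo_add (s : Set I) [DecidablePred (· ∈ s)] (x : EuclideanSpace ℂ I) :
    ‖x‖ ^ 2 = (∑ i, if i ∈ s then ‖x i‖ ^ 2 else 0) + ‖restrictTo sᶜ x‖ ^ 2 := by
  rw [EuclideanSpace.norm_sq_eq, EuclideanSpace.norm_sq_eq, ← Finset.sum_add_distrib]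
  refine Finset.sum_congr rfl fun i _ => ?_
  by_cases hi : i ∈ s <;> simp [restrictTo, hi]

/-- Comparison of the low-energy spaces of two Hermitian matrices that are diagonal at the indices
in `s`: at these indices only the size of the diagonal entries of the second one matters, and at
the others the quadratic forms differ by at most `δ`. -/
theorem finrank_lowSpace_le_of_form_le [DecidableEq I] {M₀ M₁ : Matrix I I ℂ} (h₀ : M₀.IsHermitian)
    (h₁ : M₁.IsHermitian) {s : Set I} [DecidablePred (· ∈ s)]
    (hs₀ : ∀ i ∈ s, ∀ j, j ≠ i → M₀ i j = 0 ∧ M₀ j i = 0)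
    (hs₁ : ∀ i ∈ s, ∀ j, j ≠ i → M₁ i j = 0 ∧ M₁ j i = 0) {t δ : ℝ}
    (hdiag : ∀ i ∈ s, (M₁ i i).re ≤ t + δ)
    (hform : ∀ x : EuclideanSpace ℂ I, (∀ i ∈ s, x i = 0) →
      (inner ℂ x (M₁.toEuclideanLin x)).re ≤
        (inner ℂ x (M₀.toEuclideanLin x)).re + δ * ‖x‖ ^ 2) :
    Module.finrank ℂ (lowSpace M₀.toEuclideanLin t) ≤
      Module.finrank ℂ (lowSpace M₁.toEuclideanLin (t + δ)) := by
  have s₀ := Matrix.isSymmetric_toEuclideanLin_iff.2 h₀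
  have s₁ := Matrix.isSymmetric_toEuclideanLin_iff.2 h₁
  refine finrank_le_finrank_lowSpace s₁ _ fun x hx => ?_
  have h2 := re_inner_le_of_mem_lowSpace s₀ (restrictTo_compl_mem_lowSpace hs₀ hx)
  have h3 := hform (restrictTo sᶜ x) fun i hi => by simp [restrictTo, hi]
  have h4 : (∑ i, if i ∈ s then (M₁ i i).re * ‖x i‖ ^ 2 else 0) ≤
      (t + δ) * ∑ i, if i ∈ s then ‖x i‖ ^ 2 else 0 := by
    rw [Finset.mul_sum]
    refine Finset.sum_le_sum fun i _ => ?_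
    split_ifs with hi
    · gcongr
      exact hdiag i hi
    · simp
  rw [re_inner_eq_restrictTo_add hs₁ x, norm_sq_eq_restrictTo_add s x]
  linarith

/-- Schur's test for the difference of two quadratic forms. -/
theorem re_inner_le_add_of_schur [DecidableEq I] {M₀ M₁ : Matrix I I ℂ} {s : Set I}
    {g : I → I → ℝ} {δ : ℝ} (hg : ∀ i j, 0 ≤ g i j) (hsymm : ∀ i j, g i j = g j i)
    (hsum : ∀ j, ∑ i, g i j ≤ δ)
    (hle : ∀ i ∉ s, ∀ j ∉ s, ‖M₁ i j - M₀ i j‖ ≤ g i j)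
    (x : EuclideanSpace ℂ I) (hx : ∀ i ∈ s, x i = 0) :
    (inner ℂ x (M₁.toEuclideanLin x)).re ≤
      (inner ℂ x (M₀.toEuclideanLin x)).re + δ * ‖x‖ ^ 2 := by
  rw [← sub_le_iff_le_add', inner_toEuclideanLin, inner_toEuclideanLin, ← Complex.sub_re,
    ← Finset.sum_sub_distrib]
  simp_rw [← Finset.sum_sub_distrib]
  have key : ∀ i j, (star (x i) * M₁ i j * x j - star (x i) * M₀ i j * x j).re ≤
      g i j * ‖x i‖ ^ 2 / 2 + g j i * ‖x j‖ ^ 2 / 2 := by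
    intro i j
    rw [hsymm j i]
    have hnn := hg i j
    by_cases hi : i ∈ s
    · simp only [hx i hi, star_zero, zero_mul, sub_zero, Complex.zero_re]
      positivity
    by_cases hj : j ∈ s
    · simp only [hx j hj, mul_zero, sub_zero, Complex.zero_re]
      positivity
    have h1 : star (x i) * M₁ i j * x j - star (x i) * M₀ i j * x j =
        star (x i) * (M₁ i j - M₀ i j) * x j := by ring
    have h2 : ‖star (x i) * (M₁ i j - M₀ i j) * x j‖ ≤ ‖x i‖ * g i j * ‖x j‖ := by
      rw [norm_mul, norm_mul, norm_star]
      gcongr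
      exact hle i hi j hj
    rw [h1]
    refine (Complex.re_le_norm _).trans (h2.trans ?_)
    nlinarith [mul_nonneg hnn (sq_nonneg (‖x i‖ - ‖x j‖))]
  have hrow : ∀ i, ∑ j, g i j * ‖x i‖ ^ 2 / 2 ≤ δ * ‖x i‖ ^ 2 / 2 := by
    intro i
    rw [← Finset.sum_div, ← Finset.sum_mul]
    have : ∑ j, g i j ≤ δ := by simpa only [hsymm i] using hsum i
    gcongr
  have h3 : ∑ i, ∑ j, g j i * ‖x j‖ ^ 2 / 2 ≤ ∑ j, δ * ‖x j‖ ^ 2 / 2 := by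
    rw [Finset.sum_comm]
    exact Finset.sum_le_sum fun j _ => hrow j
  have h4 : ∑ i, ∑ j, g i j * ‖x i‖ ^ 2 / 2 ≤ ∑ i, δ * ‖x i‖ ^ 2 / 2 :=
    Finset.sum_le_sum fun i _ => hrow i
  have h5 : (∑ i, ∑ j, (star (x i) * M₁ i j * x j - star (x i) * M₀ i j * x j)).re ≤
      (∑ i, ∑ j, g i j * ‖x i‖ ^ 2 / 2) + ∑ i, ∑ j, g j i * ‖x j‖ ^ 2 / 2 := by
    simp_rw [Complex.re_sum, ← Finset.sum_add_distrib]
    exact Finset.sum_le_sum fun i _ => Finset.sum_le_sum fun j _ => key i j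
  have h6 : δ * ‖x‖ ^ 2 = (∑ i, δ * ‖x i‖ ^ 2 / 2) + ∑ i, δ * ‖x i‖ ^ 2 / 2 := by
    rw [EuclideanSpace.norm_sq_eq, Finset.mul_sum, ← Finset.sum_add_distrib]
    exact Finset.sum_congr rfl fun i _ => by ring
  linarith

end Matrices

/-! ### The dual lattice -/

section DualLattice

variable {d : ℕ} (v : Module.Basis (Fin d) ℝ (Space d))

theorem exists_dual_basis : ∃ w : Module.Basis (Fin d) ℝ (Space d),
    ∀ i j, inner ℝ (w i) (v j) = if i = j then 2 * Real.pi else 0 := by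
  let B : LinearMap.BilinForm ℝ (Space d) := (2 * Real.pi)⁻¹ • innerₗ (Space d)
  have hBa : ∀ x y, B x y = (2 * Real.pi)⁻¹ * inner ℝ x y := fun x y => rfl
  have hpi := Real.two_pi_pos
  have hB : B.Nondegenerate := by
    constructor
    · intro x hx
      have := hx x
      rw [hBa] at this
      simpa [hpi.ne', Real.pi_ne_zero] using this
    · intro x hx
      have := hx x
      rw [hBa] at this
      simpa [hpi.ne', Real.pi_ne_zero] using this
  refine ⟨B.dualBasis hB v, fun i j => ?_⟩
  have h := B.apply_dualBasis_left hB v i j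
  rw [hBa, inv_mul_eq_iff_eq_mul₀ hpi.ne'] at h
  rw [h]
  by_cases hij : i = j
  · simp [hij]
  · simp [hij, Ne.symm hij]

/-- The basis of `ℝ^d` that is dual to `v` up to the factor `2π`; it generates the dual lattice. -/
noncomputable def dualLatticeBasis : Module.Basis (Fin d) ℝ (Space d) := (exists_dual_basis v).choose

theorem inner_dualLatticeBasis (i j : Fin d) :
    inner ℝ (dualLatticeBasis v i) (v j) = if i = j then 2 * Real.pi else 0 :=
  (exists_dual_basis v).choose_spec i j

/-- The element of the dual lattice with given integer coordinates. -/
noncomputable def dualVec (n : Fin d → ℤ) : Space d := ∑ i, n i • dualLatticeBasis v i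

theorem inner_dualVec (n : Fin d → ℤ) (x : Space d) :
    inner ℝ (dualVec v n) x = 2 * Real.pi * ∑ i, n i * v.repr x i := by
  have h : ∀ i, inner ℝ (dualLatticeBasis v i) x = 2 * Real.pi * v.repr x i := by
    intro i
    conv_lhs => rw [← v.sum_repr x]
    rw [inner_sum]
    simp_rw [real_inner_smul_right, inner_dualLatticeBasis]
    simp [mul_comm]
  rw [dualVec, sum_inner, Finset.mul_sum]
  refine Finset.sum_congr rfl fun i _ => ?_
  rw [← Int.cast_smul_eq_zsmul ℝ, real_inner_smul_left, h]
  ring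

theorem dualVec_mem (n : Fin d → ℤ) : dualVec v n ∈ dualLattice v := by
  intro γ hγ
  induction hγ using Submodule.span_induction with
  | mem x hx =>
    obtain ⟨j, rfl⟩ := hx
    refine ⟨n j, ?_⟩
    rw [inner_dualVec]
    simp [Finsupp.single_apply]
  | zero => exact ⟨0, by simp⟩
  | add x y _ _ hx hy =>
    obtain ⟨p, hp⟩ := hx
    obtain ⟨q, hq⟩ := hy
    exact ⟨p + q, by rw [inner_add_right, hp, hq]; push_cast; ring⟩
  | smul a x _ hx =>
    obtain ⟨p, hp⟩ := hx
    refine ⟨a * p, ?_⟩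
    rw [← Int.cast_smul_eq_zsmul ℝ, real_inner_smul_right, hp]
    push_cast
    ring

theorem exists_dualVec_eq {θ : Space d} (hθ : θ ∈ dualLattice v) : ∃ n, dualVec v n = θ := by
  choose n hn using fun i => hθ (v i) (Submodule.subset_span ⟨i, rfl⟩)
  refine ⟨n, ?_⟩
  have h0 : innerₛₗ ℝ (dualVec v n) = innerₛₗ ℝ θ := v.ext fun i => by
    rw [innerₛₗ_apply_apply, innerₛₗ_apply_apply, hn i, inner_dualVec]
    simp [Finsupp.single_apply]
  exact ext_inner_right ℝ fun x => LinearMap.congr_fun h0 x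

theorem mem_dualLattice_iff (θ : Space d) :
    θ ∈ dualLattice v ↔ θ ∈ Submodule.span ℤ (Set.range (dualLatticeBasis v)) := by
  constructor
  · intro h
    obtain ⟨n, rfl⟩ := exists_dualVec_eq v h
    exact Submodule.sum_mem _ fun i _ => Submodule.smul_mem _ _ (Submodule.subset_span ⟨i, rfl⟩)
  · intro h
    obtain ⟨n, rfl⟩ := (Submodule.mem_span_range_iff_exists_fun ℤ).1 h
    exact dualVec_mem v n

theorem finite_dualLattice_ball (k : Space d) (R : ℝ) :
    {n : dualLattice v | ‖(n : Space d) + k‖ ≤ R}.Finite := by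
  have h := ZSpan.setFinite_inter (dualLatticeBasis v)
    (Metric.isBounded_closedBall (x := -k) (r := R))
  refine Set.Finite.of_finite_image (f := fun n : dualLattice v => (n : Space d)) (h.subset ?_)
    Subtype.val_injective.injOn
  rintro _ ⟨n, hn, rfl⟩
  refine ⟨?_, (mem_dualLattice_iff v _).1 n.2⟩
  rw [Metric.mem_closedBall, dist_eq_norm, sub_neg_eq_add]
  exact hn

/-- A bound for the distance from any point of `ℝ^d` to the dual lattice. -/
theorem exists_norm_sub_dualLattice_le :
    ∃ D : ℝ, 1 ≤ D ∧ ∀ η : Space d, ∃ n ∈ dualLattice v, ‖η - n‖ ≤ D := by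
  refine ⟨1 + ∑ i, ‖dualLatticeBasis v i‖, ?_, fun η => ?_⟩
  · have : 0 ≤ ∑ i, ‖dualLatticeBasis v i‖ := Finset.sum_nonneg fun i _ => norm_nonneg _
    linarith
  · refine ⟨ZSpan.floor (dualLatticeBasis v) η, (mem_dualLattice_iff v _).2 (Subtype.mem _), ?_⟩
    have := ZSpan.norm_fract_le (dualLatticeBasis v) η
    rw [ZSpan.fract_apply] at this
    linarith

theorem one_le_japanese (t : Space d) : 1 ≤ japanese t := by
  rw [japanese, Real.one_le_sqrt]
  nlinarith [sq_nonneg ‖t‖]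

theorem japanese_pos (t : Space d) : 0 < japanese t := one_pos.trans_le (one_le_japanese t)

theorem norm_le_japanese (t : Space d) : ‖t‖ ≤ japanese t := by
  rw [japanese]
  apply Real.le_sqrt_of_sq_le
  linarith

/-- The sums of `⟨θ⟩^{-l}` over finite subsets of the dual lattice are bounded if `l > d`. -/
theorem exists_sum_japanese_rpow_le {l : ℝ} (hl : (d : ℝ) < l) :
    ∃ S : ℝ, 0 < S ∧ ∀ F : Finset (Space d), (∀ θ ∈ F, θ ∈ dualLattice v) →
      ∑ θ ∈ F, japanese θ ^ (-l) ≤ S := by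
  let L := Submodule.span ℤ (Set.range (dualLatticeBasis v))
  have hl0 : 0 < l := (Nat.cast_nonneg d).trans_lt hl
  have hrank : Module.finrank ℤ L = d := by
    rw [ZLattice.rank ℝ L]
    simp
  have hs := ZLattice.summable_norm_rpow L (-l) (by rw [hrank]; linarith)
  refine ⟨1 + ∑' z : L, ‖z‖ ^ (-l), ?_, fun F hF => ?_⟩
  · have : 0 ≤ ∑' z : L, ‖z‖ ^ (-l) := tsum_nonneg fun z => by positivity
    linarith
  · classical
    have h1 : ∀ θ ∈ F, japanese θ ^ (-l) ≤ (if θ = 0 then 1 else 0) + ‖θ‖ ^ (-l) := by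
      intro θ _
      by_cases h0 : θ = 0
      · subst h0
        have : (0 : ℝ) ≤ ‖(0 : Space d)‖ ^ (-l) := by positivity
        have h2 := Real.rpow_le_one_of_one_le_of_nonpos (one_le_japanese (0 : Space d))
          (neg_nonpos.2 hl0.le)
        rw [if_pos rfl]
        linarith
      · rw [if_neg h0, zero_add]
        exact Real.rpow_le_rpow_of_nonpos (norm_pos_iff.2 h0) (norm_le_japanese θ)
          (neg_nonpos.2 hl0.le)
    refine (Finset.sum_le_sum h1).trans ?_
    rw [Finset.sum_add_distrib]
    refine add_le_add ?_ ?_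
    · rw [Finset.sum_ite_eq']
      split_ifs <;> norm_num
    · rw [← Finset.sum_attach]
      let g : {θ // θ ∈ F} → L := fun θ => ⟨θ, (mem_dualLattice_iff v _).1 (hF θ θ.2)⟩
      have hg : Function.Injective g := fun a b hab =>
        Subtype.ext (congrArg (fun z : L => (z : Space d)) hab)
      calc ∑ θ ∈ F.attach, ‖(θ : Space d)‖ ^ (-l) = ∑ z ∈ F.attach.map ⟨g, hg⟩, ‖z‖ ^ (-l) := by
            rw [Finset.sum_map]; rfl
        _ ≤ _ := hs.sum_le_tsum _ fun z _ => by positivity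

end DualLattice

/-! ### Fourier series on the cell -/

section Fourier

variable {d : ℕ} (v : Module.Basis (Fin d) ℝ (Space d))

theorem expo_add (θ τ x : Space d) : expo (θ + τ) x = expo θ x * expo τ x := by
  rw [expo, expo, expo, ← Complex.exp_add, inner_add_left]
  push_cast
  ring_nf

theorem expo_add_right (θ x y : Space d) : expo θ (x + y) = expo θ x * expo θ y := by
  rw [expo, expo, expo, ← Complex.exp_add, inner_add_right]
  push_cast
  ring_nf

theorem expo_zero (x : Space d) : expo 0 x = 1 := by simp [expo]

theorem star_expo (θ x : Space d) : star (expo θ x) = expo (-θ) x := by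
  rw [expo, expo, ← starRingEnd_apply, ← Complex.exp_conj, map_mul, Complex.conj_I,
    Complex.conj_ofReal, inner_neg_left]
  push_cast
  ring_nf

theorem expo_eq_one_of_mem {θ γ : Space d} (hθ : θ ∈ dualLattice v) (hγ : γ ∈ lattice v) :
    expo θ γ = 1 := by
  obtain ⟨n, hn⟩ := hθ γ hγ
  rw [expo, hn, Complex.exp_eq_one_iff]
  exact ⟨n, by push_cast; ring⟩

instance isFiniteMeasure_cellMeasure : IsFiniteMeasure (cellMeasure v) :=
  ⟨by rw [cellMeasure, Measure.restrict_apply_univ]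
      exact (ZSpan.fundamentalDomain_isBounded v).measure_lt_top⟩

theorem latticeDet_pos : 0 < latticeDet v := by
  rw [latticeDet, Measure.real, ENNReal.toReal_pos_iff]
  exact ⟨pos_iff_ne_zero.2 (ZSpan.measure_fundamentalDomain_ne_zero v),
    (ZSpan.fundamentalDomain_isBounded v).measure_lt_top⟩

open scoped Pointwise in
/-- The integral over the cell of a non-trivial exponential of the dual lattice vanishes. -/
theorem integral_expo_eq_zero {θ : Space d} (hθ : θ ∈ dualLattice v) (h0 : θ ≠ 0) :
    ∫ x in cell v, expo θ x = 0 := by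
  -- translation by `y` multiplies the integral by `e^{i⟨θ, y⟩} = -1`
  let y : Space d := (Real.pi / ‖θ‖ ^ 2) • θ
  have hy : expo θ y = -1 := by
    have h1 : ‖θ‖ ≠ 0 := norm_ne_zero_iff.2 h0
    rw [expo, real_inner_smul_right, real_inner_self_eq_norm_sq, div_mul_cancel₀ _ (by positivity),
      mul_comm, Complex.exp_pi_mul_I]
  have hF := ZSpan.isAddFundamentalDomain' v (volume : Measure (Space d))
  have hcount : Countable (Submodule.span ℤ (Set.range v)).toAddSubgroup :=
    inferInstanceAs (Countable (Submodule.span ℤ (Set.range v)))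
  have hG := hF.vadd_of_comm y
  have hinv : ∀ (g : (Submodule.span ℤ (Set.range v)).toAddSubgroup) (x : Space d),
      expo θ (g +ᵥ x) = expo θ x := by
    intro g x
    change expo θ ((g : Space d) + x) = _
    rw [expo_add_right, expo_eq_one_of_mem v hθ g.2, one_mul]
  have h2 : ∫ x in (y +ᵥ cell v), expo θ x = ∫ x in cell v, expo θ x := hG.setIntegral_eq hF hinv
  have h3 : ∫ x in (y +ᵥ cell v), expo θ x = ∫ x in cell v, expo θ (y + x) := by
    have := (measurePreserving_add_left (volume : Measure (Space d)) y).setIntegral_image_emb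
      (measurableEmbedding_addLeft y) (expo θ) (cell v)
    rw [← this]
    rfl
  simp_rw [h3, expo_add_right, hy] at h2
  rw [integral_const_mul] at h2
  linear_combination (-1 / 2 : ℂ) * h2

theorem memLp_expo (θ : Space d) : MemLp
    (fun x => ((Real.sqrt (latticeDet v) : ℝ) : ℂ)⁻¹ * expo θ x) 2 (cellMeasure v) := by
  refine MemLp.of_bound (continuous_const.mul (continuous_expo θ)).aestronglyMeasurable
    ‖((Real.sqrt (latticeDet v) : ℝ) : ℂ)⁻¹‖ (Filter.Eventually.of_forall fun x => ?_)
  rw [norm_mul, norm_expo, mul_one]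

/-- The normalized exponential `d(Γ)^{-1/2} e^{i⟨θ, x⟩}` as an element of `L²(𝒪)`. -/
noncomputable def expoLp (θ : Space d) : FibreSpace v := (memLp_expo v θ).toLp _

theorem coeffL_eq_inner (θ : Space d) (u : FibreSpace v) :
    coeffL v θ u = inner ℂ (expoLp v θ) u := by
  change cellCoeff v u θ = _
  rw [cellCoeff, L2.inner_def, ← integral_const_mul]
  refine integral_congr_ae ?_
  filter_upwards [(memLp_expo v θ).coeFn_toLp] with x hx
  rw [expoLp, hx, RCLike.inner_apply, map_mul, starRingEnd_apply, starRingEnd_apply, star_expo,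
    star_inv₀, ← starRingEnd_apply, Complex.conj_ofReal]
  ring

theorem coeffL_expoLp {θ τ : Space d} (hθ : θ ∈ dualLattice v) (hτ : τ ∈ dualLattice v) :
    coeffL v θ (expoLp v τ) = if τ = θ then 1 else 0 := by
  change cellCoeff v (expoLp v τ) θ = _
  have h1 : ∫ x in cell v, expo (-θ) x * (expoLp v τ) x =
      ∫ x in cell v, ((Real.sqrt (latticeDet v) : ℝ) : ℂ)⁻¹ * expo (τ - θ) x := by
    refine integral_congr_ae ?_
    filter_upwards [(memLp_expo v τ).coeFn_toLp] with x hx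
    rw [expoLp, hx, sub_eq_add_neg, expo_add]
    ring
  have hd := latticeDet_pos v
  have hs : (((Real.sqrt (latticeDet v) : ℝ) : ℂ)) * ((Real.sqrt (latticeDet v) : ℝ) : ℂ) =
      (latticeDet v : ℂ) := by
    rw [← Complex.ofReal_mul, Real.mul_self_sqrt hd.le]
  have hs0 : ((Real.sqrt (latticeDet v) : ℝ) : ℂ) ≠ 0 := by
    rw [Complex.ofReal_ne_zero]
    exact (Real.sqrt_pos.2 hd).ne'
  rw [cellCoeff, h1, integral_const_mul]
  split_ifs with h
  · subst h
    simp_rw [sub_self, expo_zero]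
    rw [setIntegral_const, Complex.real_smul, mul_one]
    field_simp
    rw [sq, hs]
    rfl
  · rw [integral_expo_eq_zero v (sub_mem hτ hθ) (sub_ne_zero.2 h)]
    simp

/-- The covering map from `ℝ^d` to the standard torus, in the coordinates given by `v`. -/
noncomputable def toTorus (x : Space d) : UnitAddTorus (Fin d) := fun i => (v.repr x i : UnitAddCircle)

/-- The section of `toTorus` with values in the cell. -/
noncomputable def ofTorus (y : UnitAddTorus (Fin d)) : Space d :=
  ∑ i, (AddCircle.measurableEquivIco 1 0 (y i) : ℝ) • v i

theorem continuous_toTorus : Continuous (toTorus v) := by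
  refine continuous_pi fun i => (AddCircle.continuous_mk' 1).comp ?_
  exact ((v.coord i).continuous_of_finiteDimensional)

theorem measurable_ofTorus : Measurable (ofTorus v) := by
  refine Finset.measurable_sum _ fun i _ => Measurable.smul_const ?_ _
  exact measurable_subtype_coe.comp
    ((AddCircle.measurableEquivIco 1 0).measurable.comp (measurable_pi_apply i))

theorem ofTorus_toTorus {x : Space d} (hx : x ∈ cell v) : ofTorus v (toTorus v x) = x := by
  conv_rhs => rw [← v.sum_repr x]
  refine Finset.sum_congr rfl fun i _ => ?_
  congr 1
  have hi := (ZSpan.mem_fundamentalDomain v).1 hx i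
  have h := (AddCircle.equivIco (1 : ℝ) 0).apply_symm_apply ⟨v.repr x i, by simpa using hi⟩
  exact congrArg Subtype.val h

theorem mFourier_toTorus (n : Fin d → ℤ) (x : Space d) :
    UnitAddTorus.mFourier n (toTorus v x) = expo (dualVec v n) x := by
  rw [expo, inner_dualVec, UnitAddTorus.mFourier]
  simp only [ContinuousMap.coe_mk, toTorus, fourier_coe_apply]
  rw [← Complex.exp_sum]
  congr 1
  push_cast
  rw [Finset.mul_sum, Finset.mul_sum]
  refine Finset.sum_congr rfl fun i _ => ?_
  ring

/-- Completeness of the exponentials of the dual lattice in `L²(𝒪)`. -/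
theorem eq_zero_of_coeffL_eq_zero {u : FibreSpace v} (hu : ∀ θ ∈ dualLattice v, coeffL v θ u = 0) :
    u = 0 := by
  -- transport `u` to the torus with the image `μ` of the measure of the cell, where
  -- trigonometric polynomials are dense by the Stone-Weierstrass theorem
  let μ : Measure (UnitAddTorus (Fin d)) := (cellMeasure v).map (toTorus v)
  have hmeas : Measurable (toTorus v) := (continuous_toTorus v).measurable
  have hsec : ∀ᵐ x ∂cellMeasure v, ofTorus v (toTorus v x) = x :=
    ae_restrict_of_forall_mem (ZSpan.fundamentalDomain_measurableSet v)
      fun x hx => ofTorus_toTorus v hx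
  have hmap : μ.map (ofTorus v) = cellMeasure v := by
    rw [Measure.map_map (measurable_ofTorus v) hmeas]
    exact (Measure.map_congr hsec).trans Measure.map_id
  have hpres : MeasurePreserving (ofTorus v) μ (cellMeasure v) := ⟨measurable_ofTorus v, hmap⟩
  have hfin : IsFiniteMeasure μ := Measure.isFiniteMeasure_map _ _
  let w : Lp ℂ 2 μ := Lp.compMeasurePreserving (ofTorus v) hpres u
  have hw : w =ᵐ[μ] u ∘ ofTorus v := Lp.coeFn_compMeasurePreserving u hpres
  have hwu : ∀ᵐ x ∂cellMeasure v, w (toTorus v x) = u x := by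
    filter_upwards [ae_of_ae_map hmeas.aemeasurable hw, hsec] with x h1 h2
    rw [h1, Function.comp_apply, h2]
  have horth : ∀ n : Fin d → ℤ,
      inner ℂ (ContinuousMap.toLp (E := ℂ) 2 μ ℂ (UnitAddTorus.mFourier n)) w = 0 := by
    intro n
    have h1 := hu _ (dualVec_mem v n)
    change cellCoeff v u _ = 0 at h1
    have hs0 : ((Real.sqrt (latticeDet v) : ℝ) : ℂ) ≠ 0 := by
      rw [Complex.ofReal_ne_zero]
      exact (Real.sqrt_pos.2 (latticeDet_pos v)).ne'
    rw [cellCoeff, mul_eq_zero, or_iff_right (inv_ne_zero hs0)] at h1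
    rw [L2.inner_def, ← h1]
    have h2 : ∫ y, inner ℂ (ContinuousMap.toLp (E := ℂ) 2 μ ℂ (UnitAddTorus.mFourier n) y) (w y) ∂μ
        = ∫ y, w y * star (UnitAddTorus.mFourier n y) ∂μ := by
      refine integral_congr_ae ?_
      filter_upwards [ContinuousMap.coeFn_toLp (E := ℂ) (p := 2) (𝕜 := ℂ) μ
        (UnitAddTorus.mFourier n)] with y hy
      rw [hy, RCLike.inner_apply, starRingEnd_apply]
    rw [h2, integral_map hmeas.aemeasurable]
    · refine integral_congr_ae ?_
      filter_upwards [hwu] with x hx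
      rw [hx, mFourier_toTorus, star_expo, mul_comm]
    · exact (Lp.aestronglyMeasurable w).mul
        (continuous_star.comp (UnitAddTorus.mFourier n).continuous).aestronglyMeasurable
  have hdense : (Submodule.span ℂ (Set.range fun n : Fin d → ℤ =>
      ContinuousMap.toLp (E := ℂ) 2 μ ℂ (UnitAddTorus.mFourier n))).topologicalClosure = ⊤ := by
    have := (ContinuousMap.toLp_denseRange ℂ μ ℂ
      (by norm_num : (2 : ℝ≥0∞) ≠ ⊤)).topologicalClosure_map_submodule
      UnitAddTorus.span_mFourier_closure_eq_top
    rw [Submodule.map_span, ← Set.range_comp] at this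
    exact this
  have hw0 : w = 0 := by
    have hmem : w ∈ (Submodule.span ℂ (Set.range fun n : Fin d → ℤ =>
        ContinuousMap.toLp (E := ℂ) 2 μ ℂ (UnitAddTorus.mFourier n)))ᗮ := by
      rw [Submodule.mem_orthogonal]
      intro z hz
      induction hz using Submodule.span_induction with
      | mem z hz =>
        obtain ⟨n, rfl⟩ := hz
        exact horth n
      | zero => exact inner_zero_left _
      | add a b _ _ ha hb => rw [inner_add_left, ha, hb, add_zero]
      | smul c a _ ha => rw [inner_smul_left, ha, mul_zero]
    rw [(Submodule.topologicalClosure_eq_top_iff).1 hdense] at hmem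
    exact (Submodule.mem_bot ℂ).1 hmem
  rw [Lp.eq_zero_iff_ae_eq_zero]
  have hw1 := (Lp.eq_zero_iff_ae_eq_zero (f := w)).1 hw0
  filter_upwards [hwu, ae_of_ae_map hmeas.aemeasurable hw1] with x h1 h2
  rw [← h1, h2]
  rfl

end Fourier

/-! ### Fibres of operators whose symbols are trigonometric polynomials -/

section Fibre

variable {d : ℕ} (v : Module.Basis (Fin d) ℝ (Space d))

/-- The symbol `a` is a trigonometric polynomial in `x`: it is the sum of `c θ ξ e^{i⟨θ, x⟩}` over
a finite set `Θ` of dual lattice vectors, outside which the coefficients `c` vanish. -/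
structure IsTrigSymbol (a c : Space d → Space d → ℂ) (Θ : Finset (Space d)) : Prop where
  mem_dual : ∀ θ ∈ Θ, θ ∈ dualLattice v
  eq_sum : ∀ x ξ, a x ξ = ∑ θ ∈ Θ, c θ ξ * expo θ x
  eq_zero : ∀ θ ∉ Θ, ∀ ξ, c θ ξ = 0

variable {v} {a c : Space d → Space d → ℂ} {Θ : Finset (Space d)} (h : IsTrigSymbol v a c Θ)
  (ha : ∀ ξ, Continuous fun x => a x ξ) (s : ℝ)

include h

theorem IsTrigSymbol.fibreTerm_eq (k n : Space d) :
    fibreTerm v a ha k n = ∑ θ ∈ Θ, c θ (n + k) • expoLp v (n + θ) := by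
  apply Lp.ext
  have h1 : ∀ᵐ x ∂cellMeasure v, ∀ θ ∈ Θ, (c θ (n + k) • expoLp v (n + θ) : FibreSpace v) x =
      c θ (n + k) * (((Real.sqrt (latticeDet v) : ℝ) : ℂ)⁻¹ * expo (n + θ) x) := by
    refine (Filter.eventually_all_finset Θ).2 fun θ _ => ?_
    filter_upwards [Lp.coeFn_smul (c θ (n + k)) (expoLp v (n + θ)),
      (memLp_expo v (n + θ)).coeFn_toLp] with x hx hx'
    rw [hx, Pi.smul_apply, expoLp, hx', smul_eq_mul]
  filter_upwards [(memLp_fibreFun v a ha k n).coeFn_toLp, h1,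
    Lp.coeFn_finsetSum Θ fun θ => c θ (n + k) • expoLp v (n + θ)] with x hx hx1 hx2
  rw [fibreTerm, hx, hx2, Finset.sum_apply, Finset.sum_congr rfl hx1, fibreFun, h.eq_sum,
    Finset.mul_sum, Finset.mul_sum]
  refine Finset.sum_congr rfl fun θ _ => ?_
  rw [expo_add]
  ring

theorem IsTrigSymbol.coeffL_fibreTerm (k : Space d) (n n' : dualLattice v) :
    coeffL v n' (fibreTerm v a ha k n) = c (n' - n) (n + k) := by
  rw [h.fibreTerm_eq ha, map_sum, Finset.sum_congr rfl fun θ hθ => by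
    rw [map_smul, coeffL_expoLp v n'.2 (add_mem n.2 (h.mem_dual θ hθ)), smul_eq_mul]]
  by_cases hm : (n' - n : Space d) ∈ Θ
  · rw [Finset.sum_eq_single_of_mem _ hm]
    · simp
    · intro θ _ hne
      rw [if_neg, mul_zero]
      rintro h1
      exact hne (by rw [← h1]; abel)
  · rw [h.eq_zero _ hm]
    refine Finset.sum_eq_zero fun θ hθ => ?_
    rw [if_neg, mul_zero]
    intro h1
    refine hm ?_
    rw [← h1, add_sub_cancel_left]
    exact hθ

/-- The operator in the basis of exponentials. -/
theorem IsTrigSymbol.coeffL_fibre (k : Space d) (u : (fibre v s a ha k).domain)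
    (n' : dualLattice v) : coeffL v n' (fibre v s a ha k u) =
      ∑' n : dualLattice v, coeffL v n (u : FibreSpace v) * c (n' - n) (n + k) := by
  have hu := u.2.2
  change coeffL v n' (∑' n : dualLattice v, coeffL v n u.1 • fibreTerm v a ha k n) = _
  rw [coeffL_eq_inner, ← innerSL_apply_apply ℂ, ContinuousLinearMap.map_tsum _ hu]
  refine tsum_congr fun n => ?_
  rw [innerSL_apply_apply, ← coeffL_eq_inner, map_smul, h.coeffL_fibreTerm ha, smul_eq_mul]

omit h

/-- The block of the matrix of the fibre at `k` with indices in `S`. -/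
noncomputable def fibreMatrix (c : Space d → Space d → ℂ) (S : Finset (dualLattice v)) (k : Space d) :
    Matrix S S ℂ :=
  fun i j => c ((i : dualLattice v) - (j : dualLattice v) : Space d) ((j : dualLattice v) + k)

theorem toEuclideanLin_fibreMatrix_apply (S : Finset (dualLattice v)) (k : Space d)
    (x : EuclideanSpace ℂ S) (i : S) : (fibreMatrix c S k).toEuclideanLin x i =
      ∑ j : S, x j * c ((i : dualLattice v) - (j : dualLattice v) : Space d)
        ((j : dualLattice v) + k) := by
  simp only [Matrix.toLpLin_apply, Matrix.mulVec, dotProduct, fibreMatrix]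
  exact Finset.sum_congr rfl fun j _ => mul_comm _ _

include h

theorem IsTrigSymbol.coeffL_eq_zero_of_eigenvector {k : Space d} {S : Finset (dualLattice v)}
    {t μ : ℝ} (hμ : μ ≤ t)
    (hdec : ∀ n ∉ S, ∀ n' : dualLattice v, n' ≠ n → c (n - n') (n' + k) = 0)
    (hbig : ∀ n ∉ S, t < (c 0 (n + k)).re) {u : FibreSpace v}
    (hu : u ∈ eigenspace (fibre v s a ha k) μ) {n : dualLattice v} (hn : n ∉ S) :
    coeffL v n u = 0 := by
  obtain ⟨hd, he⟩ := hu
  have h1 := h.coeffL_fibre ha s k ⟨u, hd⟩ n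
  rw [he, map_smul, smul_eq_mul, tsum_eq_single n (fun n' hn' => by
    rw [hdec n hn n' hn', mul_zero]), sub_self, mul_comm, ← sub_eq_zero, ← mul_sub] at h1
  refine (mul_eq_zero.1 h1).resolve_right fun h2 => ?_
  have h3 := congrArg Complex.re h2
  simp only [Complex.sub_re, Complex.ofReal_re, Complex.zero_re] at h3
  have := hbig n hn
  linarith

/-- If the operator is diagonal outside `S` with diagonal entries above `t`, then the eigenvalues
`≤ t` are those of the block in `S`. -/
theorem IsTrigSymbol.countingFunction_le {k : Space d} {S : Finset (dualLattice v)} {t : ℝ}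
    (hdec : ∀ n ∉ S, ∀ n' : dualLattice v, n' ≠ n → c (n - n') (n' + k) = 0)
    (hbig : ∀ n ∉ S, t < (c 0 (n + k)).re) :
    countingFunction (fibre v s a ha k) t ≤
      (Module.finrank ℂ (lowSpace (fibreMatrix c S k).toEuclideanLin t) : ℕ∞) := by
  let W : Submodule ℂ (FibreSpace v) :=
    ⨆ μ : Set.Iic t, eigenspace (fibre v s a ha k) (μ : ℝ)
  let Ψ : FibreSpace v →ₗ[ℂ] EuclideanSpace ℂ S :=
    (WithLp.linearEquiv 2 ℂ (S → ℂ)).symm.toLinearMap ∘ₗ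
      LinearMap.pi fun i : S => coeffL v ((i : dualLattice v) : Space d)
  have hΨ : ∀ u (i : S), Ψ u i = coeffL v ((i : dualLattice v) : Space d) u := fun u i => rfl
  have hout : ∀ u ∈ W, ∀ n ∉ S, coeffL v n u = 0 := by
    intro u hu n hn
    induction hu using Submodule.iSup_induction' with
    | mem μ y hy => exact h.coeffL_eq_zero_of_eigenvector ha s μ.2 hdec hbig hy hn
    | zero => exact map_zero _
    | add y z _ _ hy hz => rw [map_add, hy, hz, add_zero]
  have hmaps : ∀ u ∈ W, Ψ u ∈ lowSpace (fibreMatrix c S k).toEuclideanLin t := by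
    intro u hu
    induction hu using Submodule.iSup_induction' with
    | mem μ y hy =>
      refine Submodule.mem_iSup_of_mem μ ?_
      rw [Module.End.mem_eigenspace_iff]
      have hy0 := fun n (hn : n ∉ S) => hout y (Submodule.mem_iSup_of_mem μ hy) n hn
      obtain ⟨hd, he⟩ := hy
      ext i
      have h1 := h.coeffL_fibre ha s k ⟨y, hd⟩ (i : dualLattice v)
      rw [he, map_smul, smul_eq_mul, tsum_eq_sum (s := S) (fun n hn => by
        rw [hy0 n hn, zero_mul]), ← Finset.sum_coe_sort] at h1
      rw [toEuclideanLin_fibreMatrix_apply, PiLp.smul_apply, smul_eq_mul, hΨ, h1]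
      rfl
    | zero => rw [map_zero]; exact zero_mem _
    | add y z _ _ hy hz => rw [map_add]; exact add_mem hy hz
  have hinj : Function.Injective (Ψ.restrict hmaps) := by
    rw [injective_iff_map_eq_zero]
    rintro ⟨u, hu⟩ hu0
    have hu1 : Ψ u = 0 := congrArg Subtype.val hu0
    refine Subtype.ext (eq_zero_of_coeffL_eq_zero v fun θ hθ => ?_)
    by_cases hS : (⟨θ, hθ⟩ : dualLattice v) ∈ S
    · have := hΨ u ⟨_, hS⟩
      rw [hu1] at this
      exact this.symm
    · exact hout u hu ⟨θ, hθ⟩ hS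
  have hrank := LinearMap.rank_le_of_injective _ hinj
  rw [← Module.finrank_eq_rank ℂ (lowSpace (fibreMatrix c S k).toEuclideanLin t)] at hrank
  have := Cardinal.toENat.monotone' hrank
  exact this.trans_eq (Cardinal.toENat_nat _)

/-- If the span of the exponentials with indices in `S` is invariant, then the eigenvalues of the
block in `S` are eigenvalues of the operator; the quasi-momenta `k` and `k + n₀` are equivalent. -/
theorem IsTrigSymbol.le_countingFunction {k n₀ : Space d} (hn₀ : n₀ ∈ dualLattice v)
    {S : Finset (dualLattice v)} {t : ℝ}
    (hinv : ∀ n ∉ S, ∀ n' ∈ S, c (n - n') (n' + k) = 0) :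
    (Module.finrank ℂ (lowSpace (fibreMatrix c S k).toEuclideanLin t) : ℕ∞) ≤
      countingFunction (fibre v s a ha (k + n₀)) t := by
  let W : Submodule ℂ (FibreSpace v) :=
    ⨆ μ : Set.Iic t, eigenspace (fibre v s a ha (k + n₀)) (μ : ℝ)
  let N₀ : dualLattice v := ⟨n₀, hn₀⟩
  let Φ : EuclideanSpace ℂ S →ₗ[ℂ] FibreSpace v :=
    (Fintype.linearCombination ℂ fun j : S =>
      expoLp v (((j : dualLattice v) - N₀ : dualLattice v) : Space d)) ∘ₗ
      (WithLp.linearEquiv 2 ℂ (S → ℂ)).toLinearMap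
  have hΦ : ∀ x (n : dualLattice v), coeffL v ((n - N₀ : dualLattice v) : Space d) (Φ x) =
      if hn : n ∈ S then x ⟨n, hn⟩ else 0 := by
    intro x n
    have h1 : Φ x = ∑ j : S, x j •
      expoLp v (((j : dualLattice v) - N₀ : dualLattice v) : Space d) := rfl
    have h2 : ∀ j : S, ((((j : dualLattice v) - N₀ : dualLattice v) : Space d) =
        ((n - N₀ : dualLattice v) : Space d)) ↔ (j : dualLattice v) = n := by
      intro j
      rw [Subtype.coe_inj, sub_left_inj]
    rw [h1, map_sum, Finset.sum_congr rfl fun j _ => by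
      rw [map_smul, coeffL_expoLp v (Subtype.mem _) (Subtype.mem _), smul_eq_mul,
        if_congr (h2 j) rfl rfl]]
    split_ifs with hn
    · rw [Finset.sum_eq_single ⟨n, hn⟩]
      · simp
      · intro j _ hj
        rw [if_neg (fun h3 => hj (Subtype.ext h3)), mul_zero]
      · simp
    · refine Finset.sum_eq_zero fun j _ => ?_
      rw [if_neg (fun h3 => hn (by rw [← h3]; exact j.2)), mul_zero]
  have hsupp : ∀ x, {n : dualLattice v | coeffL v (n : Space d) (Φ x) ≠ 0}.Finite := by
    intro x
    refine (S.finite_toSet.image fun n => n - N₀).subset fun n hn => ?_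
    refine ⟨n + N₀, ?_, add_sub_cancel_right _ _⟩
    by_contra hS
    refine hn ?_
    rw [Finset.mem_coe] at hS
    have h1 := hΦ x (n + N₀)
    rwa [add_sub_cancel_right, dif_neg hS] at h1
  have hdom : ∀ x, Φ x ∈ (fibre v s a ha (k + n₀)).domain := by
    intro x
    refine ⟨summable_of_hasFiniteSupport ((hsupp x).subset fun n hn => ?_),
      summable_of_hasFiniteSupport ((hsupp x).subset fun n hn => ?_)⟩
    · intro h0
      exact hn (by simp only [h0]; simp)
    · intro h0
      exact hn (by simp only [h0, zero_smul])
  have hmaps : ∀ x ∈ lowSpace (fibreMatrix c S k).toEuclideanLin t, Φ x ∈ W := by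
    intro x hx
    induction hx using Submodule.iSup_induction' with
    | mem μ y hy =>
      refine Submodule.mem_iSup_of_mem μ ⟨hdom y, ?_⟩
      rw [Module.End.mem_eigenspace_iff] at hy
      rw [← sub_eq_zero]
      refine eq_zero_of_coeffL_eq_zero v fun θ hθ => ?_
      obtain ⟨p, hp⟩ : ∃ p : dualLattice v, ((p - N₀ : dualLattice v) : Space d) = θ :=
        ⟨⟨θ, hθ⟩ + N₀, by rw [add_sub_cancel_right]⟩
      rw [← hp, map_sub, map_smul, smul_eq_mul, sub_eq_zero, h.coeffL_fibre ha s,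
        ← (Equiv.subRight N₀).tsum_eq, tsum_eq_sum (s := S), ← Finset.sum_coe_sort, hΦ]
      · have h1 : ∀ j : S, coeffL v ((Equiv.subRight N₀ (j : dualLattice v) : dualLattice v) :
            Space d) (Φ y) * c (((p - N₀ : dualLattice v) : Space d) -
              ((Equiv.subRight N₀ (j : dualLattice v) : dualLattice v) : Space d))
              (((Equiv.subRight N₀ (j : dualLattice v) : dualLattice v) : Space d) + (k + n₀)) =
            y j * c (p - (j : dualLattice v) : Space d) ((j : dualLattice v) + k) := by
          intro j
          rw [Equiv.subRight_apply, hΦ, dif_pos j.2]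
          congr 2
          · push_cast
            abel
          · change ((j : dualLattice v) : Space d) - n₀ + (k + n₀) = _
            abel
        rw [Finset.sum_congr rfl fun j _ => h1 j]
        split_ifs with hpS
        · have h2 := toEuclideanLin_fibreMatrix_apply (c := c) S k y ⟨p, hpS⟩
          rw [hy] at h2
          rw [← h2]
          rfl
        · rw [mul_zero]
          refine Finset.sum_eq_zero fun j _ => ?_
          rw [hinv p hpS j j.2, mul_zero]
      · intro n hn
        rw [Equiv.subRight_apply, hΦ, dif_neg hn, zero_mul]
    | zero => rw [map_zero]; exact zero_mem _
    | add y z _ _ hy hz => rw [map_add]; exact add_mem hy hz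
  have hinj : Function.Injective (Φ.restrict hmaps) := by
    rw [injective_iff_map_eq_zero]
    rintro ⟨x, hx⟩ hx0
    have hx1 : Φ x = 0 := congrArg Subtype.val hx0
    refine Subtype.ext ?_
    ext i
    have := hΦ x i
    rw [hx1, map_zero, dif_pos i.2] at this
    exact this.symm
  have hrank := LinearMap.rank_le_of_injective _ hinj
  rw [← Module.finrank_eq_rank ℂ (lowSpace (fibreMatrix c S k).toEuclideanLin t)] at hrank
  have := Cardinal.toENat.monotone' hrank
  exact (Cardinal.toENat_nat _).symm.trans_le this

end Fibre

/-! ### Elementary estimates for powers -/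

section Powers

theorem rpow_le_of_mul_le_of_le_mul {c M ρ x : ℝ} (hc : 0 < c) (hM : 0 < M) (hρ : 0 < ρ)
    (h1 : c * ρ ≤ x) (h2 : x ≤ M * ρ) (p : ℝ) : x ^ p ≤ (c ^ p + M ^ p) * ρ ^ p := by
  have hx : 0 < x := (mul_pos hc hρ).trans_le h1
  have hcp : 0 < c ^ p := Real.rpow_pos_of_pos hc p
  have hMp : 0 < M ^ p := Real.rpow_pos_of_pos hM p
  have hρp : 0 < ρ ^ p := Real.rpow_pos_of_pos hρ p
  rcases le_total 0 p with hp | hp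
  · have := Real.rpow_le_rpow hx.le h2 hp
    rw [Real.mul_rpow hM.le hρ.le] at this
    nlinarith
  · have := Real.rpow_le_rpow_of_nonpos (mul_pos hc hρ) h1 hp
    rw [Real.mul_rpow hc.le hρ.le] at this
    nlinarith

theorem abs_rpow_sub_rpow_le {p lo hi M x y : ℝ} (hp : 0 ≤ p) (hlo : 0 < lo ∨ (1 ≤ p ∧ 0 ≤ lo))
    (hM : ∀ z, lo ≤ z → z ≤ hi → z ^ (p - 1) ≤ M) (hx : x ∈ Set.Icc lo hi)
    (hy : y ∈ Set.Icc lo hi) : |y ^ p - x ^ p| ≤ p * M * |y - x| := by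
  refine (convex_Icc lo hi).norm_image_sub_le_of_norm_hasDerivWithin_le (f := fun z => z ^ p)
    (f' := fun z => p * z ^ (p - 1)) (fun z hz => ?_) (fun z hz => ?_) hx hy
  · refine (Real.hasDerivAt_rpow_const ?_).hasDerivWithinAt
    rcases hlo with h | h
    · exact Or.inl (h.trans_le hz.1).ne'
    · exact Or.inr h.1
  · have h0 : 0 ≤ lo := hlo.elim le_of_lt And.right
    rw [Real.norm_eq_abs, abs_of_nonneg (mul_nonneg hp (Real.rpow_nonneg (h0.trans hz.1) _))]
    gcongr
    exact hM z hz.1 hz.2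

theorem exists_rpow_le_half {κ : ℝ} (hκ : κ < 1) :
    ∃ ρ₁ : ℝ, 1 ≤ ρ₁ ∧ ∀ ρ, ρ₁ ≤ ρ → ρ ^ κ ≤ ρ / 2 := by
  have h1 : 0 < 1 - κ := by linarith
  refine ⟨2 ^ (1 / (1 - κ)), Real.one_le_rpow (by norm_num) (by positivity), fun ρ hρ => ?_⟩
  have h2 : (0 : ℝ) < 2 ^ (1 / (1 - κ)) := by positivity
  have hρ0 : 0 < ρ := h2.trans_le hρ
  have h3 : 2 ≤ ρ ^ (1 - κ) := by
    have := Real.rpow_le_rpow h2.le hρ h1.le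
    rwa [← Real.rpow_mul (by norm_num), one_div, inv_mul_cancel₀ h1.ne', Real.rpow_one] at this
  have h4 : ρ ^ κ * ρ ^ (1 - κ) = ρ := by
    rw [← Real.rpow_add hρ0]
    simp
  nlinarith [Real.rpow_pos_of_pos hρ0 κ]

variable {d : ℕ}

theorem japanese_le_add (ξ ξ' : Space d) : japanese ξ' ≤ japanese ξ + ‖ξ' - ξ‖ := by
  have h1 := japanese_pos ξ
  have h2 : ‖ξ'‖ ≤ ‖ξ‖ + ‖ξ' - ξ‖ := by
    have := norm_add_le ξ (ξ' - ξ)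
    rwa [add_sub_cancel] at this
  have h3 : japanese ξ ^ 2 = 1 + ‖ξ‖ ^ 2 := Real.sq_sqrt (by positivity)
  have h4 := norm_le_japanese ξ
  refine Real.sqrt_le_iff.2 ⟨by positivity, ?_⟩
  nlinarith [norm_nonneg ξ, norm_nonneg ξ', norm_nonneg (ξ' - ξ)]

theorem japanese_le_one_add_norm (ξ : Space d) : japanese ξ ≤ 1 + ‖ξ‖ := by
  refine Real.sqrt_le_iff.2 ⟨by positivity, ?_⟩
  nlinarith [norm_nonneg ξ]

/-- Peetre's inequality: powers of `⟨ξ⟩` vary by a bounded factor under bounded translations. -/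
theorem japanese_rpow_le {ξ ξ' : Space d} {D : ℝ} (h : ‖ξ' - ξ‖ ≤ D) (p : ℝ) :
    japanese ξ' ^ p ≤ (1 + D) ^ |p| * japanese ξ ^ p := by
  have hD : 0 ≤ D := (norm_nonneg _).trans h
  have key : ∀ {x y : Space d}, ‖x - y‖ ≤ D → japanese x ≤ (1 + D) * japanese y := by
    intro x y hxy
    have := japanese_le_add y x
    nlinarith [one_le_japanese y]
  rcases le_total 0 p with hp | hp
  · rw [abs_of_nonneg hp, ← Real.mul_rpow (by positivity) (japanese_pos ξ).le]
    exact Real.rpow_le_rpow (japanese_pos ξ').le (key h) hp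
  · rw [abs_of_nonpos hp]
    have h1 : japanese ξ ≤ (1 + D) * japanese ξ' := key (by rwa [norm_sub_rev])
    have h2 := Real.rpow_le_rpow_of_nonpos (japanese_pos ξ) h1 hp
    rw [Real.mul_rpow (by positivity) (japanese_pos ξ').le] at h2
    rw [Real.rpow_neg (by positivity)]
    have h3 : 0 < (1 + D) ^ p := by positivity
    rw [inv_mul_eq_div, le_div_iff₀ h3, mul_comm]
    exact h2

theorem japanese_zero_rpow (p : ℝ) : japanese (0 : Space d) ^ p = 1 := by
  simp [japanese]

end Powers

/-! ### Bounds for the Fourier coefficients of a symbol -/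

section SymbolBounds

variable {d : ℕ} {v : Module.Basis (Fin d) ℝ (Space d)} {α β l : ℝ}
  {b : Space d → Space d → ℂ}

theorem symbolNorm_nonneg (w : Space d → ℝ) (s : ℕ) : 0 ≤ symbolNorm v w α l s b :=
  ENNReal.toReal_nonneg

theorem norm_partialDeriv_le (hb : IsSymbol v (weight β) α b) (hl : 0 ≤ l) {s n : ℕ} (hn : n ≤ s)
    (σ : Fin n → Fin d) (ξ : Space d) {θ : Space d} (hθ : θ ∈ dualLattice v) :
    ‖partialDeriv (symbolCoeff v b θ) σ ξ‖ ≤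
      symbolNorm v (weight β) α l s b * japanese θ ^ (-l) * japanese ξ ^ (β * (α - n)) := by
  have h1 : ENNReal.ofReal (japanese θ ^ l * weight β ξ ^ (-α + n) *
      ‖partialDeriv (symbolCoeff v b θ) σ ξ‖) ≤ symbolENorm v (weight β) α l s b :=
    le_iSup_of_le n <| le_iSup_of_le hn <| le_iSup_of_le σ <| le_iSup_of_le ξ <|
      le_iSup_of_le (⟨θ, hθ⟩ : dualLattice v) le_rfl
  have h2 := (ENNReal.ofReal_le_iff_le_toReal (hb.norm_lt_top l hl s).ne).1 h1
  have h3 : weight β ξ ^ (-α + n) = (japanese ξ ^ (β * (α - n)))⁻¹ := by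
    rw [weight, ← Real.rpow_mul (japanese_pos ξ).le, ← Real.rpow_neg (japanese_pos ξ).le]
    congr 1
    ring
  have h4 : 0 < japanese θ ^ l := Real.rpow_pos_of_pos (japanese_pos θ) _
  have h5 : 0 < japanese ξ ^ (β * (α - n)) := Real.rpow_pos_of_pos (japanese_pos ξ) _
  rw [h3] at h2
  rw [Real.rpow_neg (japanese_pos θ).le]
  change _ ≤ symbolNorm v (weight β) α l s b at h2
  rw [mul_assoc, inv_mul_eq_div, mul_div_assoc', le_div_iff₀ h4]
  calc _ = (japanese θ ^ l * (japanese ξ ^ (β * (α - n)))⁻¹ *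
        ‖partialDeriv (symbolCoeff v b θ) σ ξ‖) * japanese ξ ^ (β * (α - n)) := by
        field_simp
    _ ≤ _ := by gcongr

theorem norm_symbolCoeff_le (hb : IsSymbol v (weight β) α b) (hl : 0 ≤ l) (ξ : Space d)
    {θ : Space d} (hθ : θ ∈ dualLattice v) : ‖symbolCoeff v b θ ξ‖ ≤
      symbolNorm v (weight β) α l 1 b * japanese θ ^ (-l) * japanese ξ ^ (β * α) := by
  have h := norm_partialDeriv_le hb hl (zero_le_one : 0 ≤ 1) Fin.elim0 ξ hθ
  rw [partialDeriv, iteratedFDeriv_zero_apply] at h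
  simpa using h

theorem norm_fderiv_symbolCoeff_le (hb : IsSymbol v (weight β) α b) (hl : 0 ≤ l) (ξ : Space d)
    {θ : Space d} (hθ : θ ∈ dualLattice v) : ‖fderiv ℝ (symbolCoeff v b θ) ξ‖ ≤
      d * (symbolNorm v (weight β) α l 1 b * japanese θ ^ (-l) *
        japanese ξ ^ (β * (α - 1))) := by
  set Q := symbolNorm v (weight β) α l 1 b * japanese θ ^ (-l) * japanese ξ ^ (β * (α - 1)) with hQ
  have hQ0 : 0 ≤ Q := by
    have := symbolNorm_nonneg (v := v) (α := α) (l := l) (b := b) (weight β) 1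
    have := Real.rpow_nonneg (japanese_pos θ).le (-l)
    have := Real.rpow_nonneg (japanese_pos ξ).le (β * (α - 1))
    positivity
  have h : ∀ i, ‖fderiv ℝ (symbolCoeff v b θ) ξ (EuclideanSpace.single i 1)‖ ≤ Q := by
    intro i
    have := norm_partialDeriv_le hb hl (le_refl 1) (fun _ => i) ξ hθ
    rw [partialDeriv, iteratedFDeriv_one_apply] at this
    simpa [hQ] using this
  refine ContinuousLinearMap.opNorm_le_bound _ (by positivity) fun x => ?_
  have hx : x = ∑ i, x i • EuclideanSpace.single i (1 : ℝ) := by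
    conv_lhs => rw [← (EuclideanSpace.basisFun (Fin d) ℝ).sum_repr x]
    simp
  conv_lhs => rw [hx]
  rw [map_sum]
  refine (norm_sum_le _ _).trans ?_
  have h1 : ∀ i ∈ Finset.univ, ‖fderiv ℝ (symbolCoeff v b θ) ξ
      (x i • EuclideanSpace.single i (1 : ℝ))‖ ≤ Q * ‖x‖ := by
    intro i _
    rw [map_smul, norm_smul, mul_comm]
    exact mul_le_mul (h i) (PiLp.norm_apply_le x i) (norm_nonneg _) hQ0
  refine (Finset.sum_le_sum h1).trans_eq ?_
  rw [Finset.sum_const, Finset.card_univ, Fintype.card_fin, nsmul_eq_mul]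
  ring

/-- The Fourier coefficients of a symbol are Lipschitz at bounded distances. -/
theorem norm_symbolCoeff_sub_le (hb : IsSymbol v (weight β) α b) (hl : 0 ≤ l) {ξ ξ' : Space d}
    {D : ℝ} (hD : ‖ξ' - ξ‖ ≤ D) {θ : Space d} (hθ : θ ∈ dualLattice v) :
    ‖symbolCoeff v b θ ξ' - symbolCoeff v b θ ξ‖ ≤
      d * (1 + D) ^ |β * (α - 1)| * (symbolNorm v (weight β) α l 1 b * japanese θ ^ (-l) *
        japanese ξ ^ (β * (α - 1))) * ‖ξ' - ξ‖ := by
  refine (convex_closedBall ξ D).norm_image_sub_le_of_norm_fderiv_le (𝕜 := ℝ)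
    (fun z _ => ((hb.smooth θ hθ).differentiable (by simp)).differentiableAt) (fun z hz => ?_)
    (Metric.mem_closedBall_self ((norm_nonneg _).trans hD)) (by rwa [mem_closedBall_iff_norm])
  refine (norm_fderiv_symbolCoeff_le hb hl z hθ).trans ?_
  rw [mem_closedBall_iff_norm] at hz
  have h1 := japanese_rpow_le hz (β * (α - 1))
  have h2 := symbolNorm_nonneg (v := v) (α := α) (l := l) (b := b) (weight β) 1
  have h3 := Real.rpow_nonneg (japanese_pos θ).le (-l)
  calc _ ≤ d * (symbolNorm v (weight β) α l 1 b * japanese θ ^ (-l) *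
        ((1 + D) ^ |β * (α - 1)| * japanese ξ ^ (β * (α - 1)))) := by gcongr
    _ = _ := by ring

end SymbolBounds

/-! ### Cut-off functions -/

section Cutoff

variable {d : ℕ} {ι : ℝ → ℝ}

theorem IsCutoff.exists_lipschitz (hι : IsCutoff ι) :
    ∃ Λ : ℝ, 0 ≤ Λ ∧ ∀ x y, |ι x - ι y| ≤ Λ * |x - y| := by
  have hd : Differentiable ℝ ι := hι.smooth.differentiable (by simp)
  have hc : Continuous (deriv ι) := hι.smooth.continuous_deriv (by simp)
  obtain ⟨Λ, hΛ⟩ := (isCompact_Icc (a := (1 / 4 : ℝ)) (b := 1 / 2)).exists_bound_of_continuousOn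
    hc.continuousOn
  have hb : ∀ z, ‖deriv ι z‖ ≤ max Λ 0 := by
    intro z
    rcases lt_or_ge z (1 / 4) with h | h
    · have : ι =ᶠ[nhds z] fun _ => 1 := by
        filter_upwards [eventually_lt_nhds h] with y hy using hι.eq_one y hy.le
      rw [this.deriv_eq, deriv_const, norm_zero]
      exact le_max_right _ _
    rcases lt_or_ge (1 / 2) z with h' | h'
    · have : ι =ᶠ[nhds z] fun _ => 0 := by
        filter_upwards [eventually_gt_nhds h'] with y hy using hι.eq_zero y hy.le
      rw [this.deriv_eq, deriv_const, norm_zero]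
      exact le_max_right _ _
    · exact (hΛ z ⟨h, h'⟩).trans (le_max_left _ _)
  refine ⟨max Λ 0, le_max_right _ _, fun x y => ?_⟩
  exact convex_univ.norm_image_sub_le_of_norm_deriv_le (fun z _ => hd z) (fun z _ => hb z)
    (Set.mem_univ y) (Set.mem_univ x)

theorem abs_resonanceCutoff_sub_le {Λ : ℝ} (hΛ : 0 ≤ Λ) (hι : ∀ x y, |ι x - ι y| ≤ Λ * |x - y|)
    {L : ℝ} (hL : 0 < L) {θ : Space d} (hθ : θ ≠ 0) (ξ ξ' : Space d) :
    |resonanceCutoff ι L θ ξ' - resonanceCutoff ι L θ ξ| ≤ Λ * L⁻¹ * ‖ξ' - ξ‖ := by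
  have hθ' := norm_pos_iff.2 hθ
  refine (hι _ _).trans ?_
  rw [mul_assoc]
  refine mul_le_mul_of_nonneg_left ?_ hΛ
  rw [← sub_div, abs_div, abs_of_pos (mul_pos hL hθ'), div_le_iff₀ (mul_pos hL hθ')]
  refine (abs_abs_sub_abs_le_abs_sub _ _).trans ?_
  rw [← inner_sub_right, add_sub_add_right_eq_sub]
  refine (abs_real_inner_le_norm _ _).trans_eq ?_
  field_simp

theorem abs_energyCutoff_sub_le {Λ : ℝ} (hΛ : 0 ≤ Λ) (hι : ∀ x y, |ι x - ι y| ≤ Λ * |x - y|)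
    {ρ : ℝ} (hρ : 0 < ρ) (θ ξ ξ' : Space d) :
    |energyCutoff ι ρ θ ξ' - energyCutoff ι ρ θ ξ| ≤ Λ * ρ⁻¹ * ‖ξ' - ξ‖ := by
  refine (hι _ _).trans ?_
  rw [mul_assoc]
  refine mul_le_mul_of_nonneg_left ?_ hΛ
  refine (abs_abs_sub_abs_le_abs_sub _ _).trans ?_
  rw [sub_sub_sub_cancel_right, ← sub_div, abs_div, abs_of_pos hρ, div_eq_inv_mul]
  refine mul_le_mul_of_nonneg_left ?_ (inv_nonneg.2 hρ.le)
  refine (abs_norm_sub_norm_le _ _).trans_eq ?_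
  rw [add_sub_add_right_eq_sub]

theorem norm_of_energyCutoff_ne_zero (hι : IsCutoff ι) {ρ : ℝ} (hρ : 0 < ρ) {θ ξ : Space d}
    (h : energyCutoff ι ρ θ ξ ≠ 0) :
    ρ / 2 ≤ ‖ξ + (1 / 2 : ℝ) • θ‖ ∧ ‖ξ + (1 / 2 : ℝ) • θ‖ ≤ 3 * ρ / 2 := by
  have h1 : |‖ξ + (1 / 2 : ℝ) • θ‖ / ρ - 1| < 1 / 2 := by
    by_contra hc
    exact h (hι.eq_zero _ (not_lt.1 hc))
  rw [abs_lt] at h1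
  have h2 : ‖ξ + (1 / 2 : ℝ) • θ‖ = ‖ξ + (1 / 2 : ℝ) • θ‖ / ρ * ρ := (div_mul_cancel₀ _ hρ.ne').symm
  constructor <;> rw [h2] <;> nlinarith

end Cutoff

/-! ### The Fourier coefficients of the model symbol -/

section Model

variable {d : ℕ} {v : Module.Basis (Fin d) ℝ (Space d)} {m α β κ l : ℝ} {ι : ℝ → ℝ}
  {ρ r : ℝ} {b : Space d → Space d → ℂ}

open Classical in
/-- The coefficient of `e^{i⟨θ, x⟩}` in the symbol of `H₀ + B^o + B^♭`. -/
noncomputable def modelCoeff (v : Module.Basis (Fin d) ℝ (Space d)) (m β : ℝ) (ι : ℝ → ℝ)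
    (ρ r : ℝ) (b : Space d → Space d → ℂ) (θ ξ : Space d) : ℂ :=
  if θ = 0 then ((‖ξ‖ ^ (2 * m) : ℝ) : ℂ) + symbolO v b ξ
  else if θ ∈ frequencySet v r then
    ((Real.sqrt (latticeDet v) : ℝ) : ℂ)⁻¹ * (symbolCoeff v b θ ξ *
      ((resonanceCutoff ι (ρ ^ β) θ ξ * energyCutoff ι ρ θ ξ : ℝ) : ℂ))
  else 0

theorem modelCoeff_zero (ξ : Space d) :
    modelCoeff v m β ι ρ r b 0 ξ = ((‖ξ‖ ^ (2 * m) : ℝ) : ℂ) + symbolO v b ξ := if_pos rfl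

theorem modelCoeff_of_mem {θ : Space d} (hθ : θ ∈ frequencySet v r) (ξ : Space d) :
    modelCoeff v m β ι ρ r b θ ξ = ((Real.sqrt (latticeDet v) : ℝ) : ℂ)⁻¹ *
      (symbolCoeff v b θ ξ *
        ((resonanceCutoff ι (ρ ^ β) θ ξ * energyCutoff ι ρ θ ξ : ℝ) : ℂ)) := by
  rw [modelCoeff, if_neg (norm_pos_iff.1 hθ.2.1), if_pos hθ]

theorem modelCoeff_of_notMem {θ : Space d} (h0 : θ ≠ 0) (hθ : θ ∉ frequencySet v r)
    (ξ : Space d) : modelCoeff v m β ι ρ r b θ ξ = 0 := by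
  rw [modelCoeff, if_neg h0, if_neg hθ]

theorem isTrigSymbol_model : IsTrigSymbol v (modelSymbol v m β ι ρ r b)
    (modelCoeff v m β ι ρ r b) (insert 0 (frequencySet_finite v r).toFinset) where
  mem_dual θ hθ := by
    rcases Finset.mem_insert.1 hθ with rfl | h
    · exact zero_mem _
    · exact ((Set.Finite.mem_toFinset _).1 h).1
  eq_sum x ξ := by
    rw [Finset.sum_insert fun h => by simpa using ((Set.Finite.mem_toFinset _).1 h).2.1,
      modelCoeff_zero, expo_zero, mul_one, modelSymbol, symbolFlat, Finset.mul_sum]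
    congr 1
    refine Finset.sum_congr rfl fun θ hθ => ?_
    rw [modelCoeff_of_mem ((Set.Finite.mem_toFinset _).1 hθ)]
    push_cast
    ring
  eq_zero θ hθ ξ := by
    rw [Finset.mem_insert, Set.Finite.mem_toFinset, not_or] at hθ
    exact modelCoeff_of_notMem hθ.1 hθ.2 ξ

theorem neg_mem_frequencySet {θ : Space d} (hθ : θ ∈ frequencySet v r) :
    -θ ∈ frequencySet v r :=
  ⟨neg_mem hθ.1, by rw [norm_neg]; exact hθ.2.1, by rw [norm_neg]; exact hθ.2.2⟩

theorem star_symbolO (hsym : IsSymmetricSymbol v b) (ξ : Space d) :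
    star (symbolO v b ξ) = symbolO v b ξ := by
  have h := hsym 0 (zero_mem _) ξ
  rw [neg_zero, add_zero] at h
  rw [symbolO, star_mul', ← h, star_inv₀, ← starRingEnd_apply, Complex.conj_ofReal]

theorem modelCoeff_neg (hsym : IsSymmetricSymbol v b) (θ ξ : Space d) :
    modelCoeff v m β ι ρ r b (-θ) (ξ + θ) = star (modelCoeff v m β ι ρ r b θ ξ) := by
  by_cases h0 : θ = 0
  · subst h0
    rw [neg_zero, add_zero, modelCoeff_zero, star_add, star_symbolO hsym, ← starRingEnd_apply,
      Complex.conj_ofReal]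
  by_cases hθ : θ ∈ frequencySet v r
  · have h1 : ξ + θ + (1 / 2 : ℝ) • -θ = ξ + (1 / 2 : ℝ) • θ := by module
    rw [modelCoeff_of_mem hθ, modelCoeff_of_mem (neg_mem_frequencySet hθ), star_mul', star_mul',
      hsym θ hθ.1 ξ, star_star, star_inv₀, ← starRingEnd_apply, ← starRingEnd_apply,
      Complex.conj_ofReal, Complex.conj_ofReal, resonanceCutoff, resonanceCutoff, energyCutoff,
      energyCutoff, h1, inner_neg_left, abs_neg, norm_neg]
  · rw [modelCoeff_of_notMem h0 hθ, star_zero, modelCoeff_of_notMem (neg_ne_zero.2 h0)]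
    intro h
    exact hθ (by simpa using neg_mem_frequencySet h)

theorem isHermitian_fibreMatrix_model (hsym : IsSymmetricSymbol v b) (S : Finset (dualLattice v))
    (k : Space d) : (fibreMatrix (modelCoeff v m β ι ρ r b) S k).IsHermitian := by
  ext i j
  rw [Matrix.conjTranspose_apply, fibreMatrix, fibreMatrix, ← modelCoeff_neg hsym]
  congr 1
  · abel
  · abel

/-- The off-diagonal coefficients are supported near the sphere of radius `ρ`. -/
theorem norm_of_modelCoeff_ne_zero (hι : IsCutoff ι) (hρ : 0 < ρ) {θ ξ : Space d} (h0 : θ ≠ 0)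
    (h : modelCoeff v m β ι ρ r b θ ξ ≠ 0) :
    (ρ - r) / 2 ≤ ‖ξ‖ ∧ ‖ξ‖ ≤ (3 * ρ + r) / 2 ∧ (ρ - r) / 2 ≤ ‖ξ + θ‖ ∧
      ‖ξ + θ‖ ≤ (3 * ρ + r) / 2 := by
  have hθ : θ ∈ frequencySet v r := by
    by_contra hθ
    exact h (modelCoeff_of_notMem h0 hθ ξ)
  have he : energyCutoff ι ρ θ ξ ≠ 0 := by
    intro he
    refine h ?_
    rw [modelCoeff_of_mem hθ, he]
    simp
  obtain ⟨h1, h2⟩ := norm_of_energyCutoff_ne_zero hι hρ he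
  have hr := hθ.2.2
  have h3 : ‖(1 / 2 : ℝ) • θ‖ = ‖θ‖ / 2 := by
    rw [norm_smul]
    norm_num
    ring
  have h4 : ξ = ξ + (1 / 2 : ℝ) • θ - (1 / 2 : ℝ) • θ := by module
  have h5 : ξ + θ = ξ + (1 / 2 : ℝ) • θ + (1 / 2 : ℝ) • θ := by module
  have h6 := norm_sub_le (ξ + (1 / 2 : ℝ) • θ) ((1 / 2 : ℝ) • θ)
  have h7 := norm_add_le (ξ + (1 / 2 : ℝ) • θ) ((1 / 2 : ℝ) • θ)
  have h8 := norm_sub_norm_le (ξ + (1 / 2 : ℝ) • θ) ((1 / 2 : ℝ) • θ)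
  have h9 := norm_sub_norm_le (ξ + (1 / 2 : ℝ) • θ) (-((1 / 2 : ℝ) • θ))
  rw [sub_neg_eq_add, norm_neg, ← h5] at h9
  rw [← h4] at h6 h8
  rw [← h5] at h7
  refine ⟨?_, ?_, ?_, ?_⟩ <;> linarith

theorem norm_latticeDet_inv : ‖((Real.sqrt (latticeDet v) : ℝ) : ℂ)⁻¹‖ =
    (Real.sqrt (latticeDet v))⁻¹ := by
  rw [norm_inv, Complex.norm_real, Real.norm_eq_abs, abs_of_nonneg (Real.sqrt_nonneg _)]

theorem norm_symbolO_le (hb : IsSymbol v (weight β) α b) (hl : 0 ≤ l) (ξ : Space d) :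
    ‖symbolO v b ξ‖ ≤ (Real.sqrt (latticeDet v))⁻¹ * (symbolNorm v (weight β) α l 1 b *
      japanese ξ ^ (β * α)) := by
  have h := norm_symbolCoeff_le hb hl ξ (zero_mem (dualLattice v))
  rw [japanese_zero_rpow, mul_one] at h
  rw [symbolO, norm_mul, norm_latticeDet_inv]
  gcongr

variable (v) in
/-- The off-diagonal coefficients are Lipschitz with constant of order `ρ^{2m-1}`. -/
theorem exists_norm_modelCoeff_sub_le (hβ₁ : β ≤ 1) (hκ : κ < 1)
    (hcond : β * (α - 1) ≤ 2 * m - 1) (hι : IsCutoff ι) (hl : 0 ≤ l) {D : ℝ} (hD : 0 ≤ D) :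
    ∃ C : ℝ, 0 < C ∧ ∀ b, IsSymbol v (weight β) α b → ∀ ρ r, 1 ≤ ρ → r ≤ ρ ^ κ →
      ∀ θ ξ ξ' : Space d, θ ≠ 0 → ‖ξ' - ξ‖ ≤ D →
        ‖modelCoeff v m β ι ρ r b θ ξ' - modelCoeff v m β ι ρ r b θ ξ‖ ≤
          C * symbolNorm v (weight β) α l 1 b * ρ ^ (2 * m - 1) * ‖ξ' - ξ‖ *
            japanese θ ^ (-l) := by
  obtain ⟨Λ, hΛ, hlip⟩ := hι.exists_lipschitz
  obtain ⟨ρ₁, hρ₁, hhalf⟩ := exists_rpow_le_half hκ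
  let c : ℝ := (4 * ρ₁)⁻¹
  have hc : 0 < c := by positivity
  let P : ℝ → ℝ := fun p => c ^ p + 3 ^ p
  have hP : ∀ p, 0 < P p := fun p => by positivity
  let c₀ : ℝ := (Real.sqrt (latticeDet v))⁻¹
  have hc₀ : 0 < c₀ := inv_pos.2 (Real.sqrt_pos.2 (latticeDet_pos v))
  let C₁ : ℝ := d * (1 + D) ^ |β * (α - 1)|
  have hC₁ : 0 ≤ C₁ := by positivity
  refine ⟨c₀ * (C₁ * P (β * (α - 1)) + P (β * α) * (2 * Λ)) + 1,
    by have := hP (β * (α - 1)); have := hP (β * α); positivity, fun b hb ρ r hρ hr => ?_⟩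
  have hρ0 : 0 < ρ := one_pos.trans_le hρ
  set B := symbolNorm v (weight β) α l 1 b with hB
  have hB0 : 0 ≤ B := symbolNorm_nonneg _ _
  have hrρ : r ≤ ρ := hr.trans (by
    conv_rhs => rw [← Real.rpow_one ρ]
    exact Real.rpow_le_rpow_of_exponent_le hρ hκ.le)
  have hρpow : ρ ^ (β * (α - 1)) ≤ ρ ^ (2 * m - 1) := Real.rpow_le_rpow_of_exponent_le hρ hcond
  -- the japanese bracket is comparable to `ρ` on the support of the cut-off functions
  have hjap : ∀ ξ : Space d, (ρ - r) / 2 ≤ ‖ξ‖ → ‖ξ‖ ≤ (3 * ρ + r) / 2 → ∀ p,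
      japanese ξ ^ p ≤ P p * ρ ^ p := by
    intro ξ h1 h2 p
    refine rpow_le_of_mul_le_of_le_mul hc (by norm_num) hρ0 ?_ ?_ p
    · rw [inv_mul_le_iff₀ (by positivity)]
      rcases le_total ρ₁ ρ with h | h
      · have h3 := hhalf ρ h
        have h4 := norm_le_japanese ξ
        nlinarith
      · nlinarith [one_le_japanese ξ]
    · have := japanese_le_one_add_norm ξ
      linarith
  have key : ∀ θ ξ ξ' : Space d, θ ∈ frequencySet v r → ‖ξ' - ξ‖ ≤ D →
      modelCoeff v m β ι ρ r b θ ξ ≠ 0 →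
        ‖modelCoeff v m β ι ρ r b θ ξ' - modelCoeff v m β ι ρ r b θ ξ‖ ≤
          (c₀ * (C₁ * P (β * (α - 1)) + P (β * α) * (2 * Λ)) + 1) * B * ρ ^ (2 * m - 1) *
            ‖ξ' - ξ‖ * japanese θ ^ (-l) := by
    intro θ ξ ξ' hθ hξ hne
    have hθ0 : θ ≠ 0 := norm_pos_iff.1 hθ.2.1
    obtain ⟨h1, h2, -, -⟩ := norm_of_modelCoeff_ne_zero hι hρ0 hθ0 hne
    have hJ := hjap ξ h1 h2
    set j := japanese θ ^ (-l) with hj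
    have hj0 : 0 < j := Real.rpow_pos_of_pos (japanese_pos θ) _
    set f := symbolCoeff v b θ
    set ζ := resonanceCutoff ι (ρ ^ β) θ
    set e := energyCutoff ι ρ θ
    set δ := ‖ξ' - ξ‖
    have hδ : 0 ≤ δ := norm_nonneg _
    have hf1 : ‖f ξ' - f ξ‖ ≤ C₁ * (B * j * (P (β * (α - 1)) * ρ ^ (2 * m - 1))) * δ := by
      refine (norm_symbolCoeff_sub_le hb hl hξ hθ.1).trans ?_
      have := (hJ (β * (α - 1))).trans (mul_le_mul_of_nonneg_left hρpow (hP _).le)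
      gcongr
    have hf0 : ‖f ξ‖ ≤ B * j * (P (β * α) * ρ ^ (β * α)) := by
      refine (norm_symbolCoeff_le hb hl ξ hθ.1).trans ?_
      gcongr
      exact hJ _
    have hι1 : ∀ z, |ι z| ≤ 1 := fun z => by
      rw [abs_of_nonneg (hι.nonneg z)]
      exact hι.le_one z
    have hζe : |ζ ξ' * e ξ' - ζ ξ * e ξ| ≤ 2 * Λ * (ρ ^ β)⁻¹ * δ := by
      have hz := abs_resonanceCutoff_sub_le hΛ hlip (Real.rpow_pos_of_pos hρ0 β) hθ0 ξ ξ'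
      have he := abs_energyCutoff_sub_le hΛ hlip hρ0 θ ξ ξ'
      have hinv : ρ⁻¹ ≤ (ρ ^ β)⁻¹ := by
        refine inv_anti₀ (Real.rpow_pos_of_pos hρ0 β) ?_
        conv_rhs => rw [← Real.rpow_one ρ]
        exact Real.rpow_le_rpow_of_exponent_le hρ hβ₁
      have he' : |e ξ' - e ξ| ≤ Λ * (ρ ^ β)⁻¹ * δ := he.trans (by gcongr)
      have hid : ζ ξ' * e ξ' - ζ ξ * e ξ = (ζ ξ' - ζ ξ) * e ξ' + ζ ξ * (e ξ' - e ξ) := by ring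
      rw [hid]
      refine (abs_add_le _ _).trans ?_
      rw [abs_mul, abs_mul]
      have i1 : |ζ ξ' - ζ ξ| * |e ξ'| ≤ Λ * (ρ ^ β)⁻¹ * δ * 1 :=
        mul_le_mul hz (hι1 _) (abs_nonneg _) (by positivity)
      have i2 : |ζ ξ| * |e ξ' - e ξ| ≤ 1 * (Λ * (ρ ^ β)⁻¹ * δ) :=
        mul_le_mul (hι1 _) he' (abs_nonneg _) zero_le_one
      linarith
    have hχ1 : ‖((ζ ξ' * e ξ' : ℝ) : ℂ)‖ ≤ 1 := by
      rw [Complex.norm_real, Real.norm_eq_abs, abs_mul]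
      exact mul_le_one₀ (hι1 _) (abs_nonneg _) (hι1 _)
    have hpow : ρ ^ (β * α) * (ρ ^ β)⁻¹ ≤ ρ ^ (2 * m - 1) := by
      rw [← Real.rpow_neg hρ0.le, ← Real.rpow_add hρ0]
      refine Real.rpow_le_rpow_of_exponent_le hρ ?_
      linarith
    have hid : f ξ' * ((ζ ξ' * e ξ' : ℝ) : ℂ) - f ξ * ((ζ ξ * e ξ : ℝ) : ℂ) =
        (f ξ' - f ξ) * ((ζ ξ' * e ξ' : ℝ) : ℂ) +
          f ξ * ((ζ ξ' * e ξ' - ζ ξ * e ξ : ℝ) : ℂ) := by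
      push_cast
      ring
    rw [modelCoeff_of_mem hθ, modelCoeff_of_mem hθ, ← mul_sub, norm_mul, norm_latticeDet_inv, hid]
    have t1 : ‖(f ξ' - f ξ) * ((ζ ξ' * e ξ' : ℝ) : ℂ)‖ ≤
        C₁ * (B * j * (P (β * (α - 1)) * ρ ^ (2 * m - 1))) * δ := by
      rw [norm_mul]
      exact (mul_le_of_le_one_right (norm_nonneg _) hχ1).trans hf1
    have t2 : ‖f ξ * ((ζ ξ' * e ξ' - ζ ξ * e ξ : ℝ) : ℂ)‖ ≤
        B * j * P (β * α) * (2 * Λ) * ρ ^ (2 * m - 1) * δ := by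
      rw [norm_mul, Complex.norm_real, Real.norm_eq_abs]
      calc _ ≤ B * j * (P (β * α) * ρ ^ (β * α)) * (2 * Λ * (ρ ^ β)⁻¹ * δ) :=
            mul_le_mul hf0 hζe (abs_nonneg _) (by have := hP (β * α); positivity)
        _ = B * j * P (β * α) * (2 * Λ) * (ρ ^ (β * α) * (ρ ^ β)⁻¹) * δ := by ring
        _ ≤ _ := by have := (hP (β * α)).le; gcongr
    have t3 : 0 ≤ B * ρ ^ (2 * m - 1) * δ * j := by positivity
    calc _ ≤ c₀ * (C₁ * (B * j * (P (β * (α - 1)) * ρ ^ (2 * m - 1))) * δ +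
          B * j * P (β * α) * (2 * Λ) * ρ ^ (2 * m - 1) * δ) :=
          mul_le_mul_of_nonneg_left ((norm_add_le _ _).trans (add_le_add t1 t2)) hc₀.le
      _ = c₀ * (C₁ * P (β * (α - 1)) + P (β * α) * (2 * Λ)) * (B * ρ ^ (2 * m - 1) * δ * j) := by
          ring
      _ ≤ _ := by linarith
  intro θ ξ ξ' h0 hξ
  by_cases hθ : θ ∈ frequencySet v r
  · by_cases h1 : modelCoeff v m β ι ρ r b θ ξ = 0
    · by_cases h2 : modelCoeff v m β ι ρ r b θ ξ' = 0
      · rw [h1, h2, sub_zero, norm_zero]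
        have := Real.rpow_nonneg (japanese_pos θ).le (-l)
        have := hP (β * (α - 1))
        have := hP (β * α)
        positivity
      · rw [norm_sub_rev _ (modelCoeff v m β ι ρ r b θ ξ), norm_sub_rev ξ']
        exact key θ ξ' ξ hθ (by rwa [norm_sub_rev]) h2
    · exact key θ ξ ξ' hθ hξ h1
  · rw [modelCoeff_of_notMem h0 hθ, modelCoeff_of_notMem h0 hθ, sub_zero, norm_zero]
    have := Real.rpow_nonneg (japanese_pos θ).le (-l)
    have := hP (β * (α - 1))
    have := hP (β * α)
    positivity

variable (v) in
/-- The diagonal coefficient is Lipschitz with constant of order `ρ^{2m-1}` where `|ξ|` is at most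
of order `ρ`, and, if `m < 1/2`, at least of order `ρ`. -/
theorem exists_norm_modelCoeff_zero_sub_le (hm : 0 < m) (hcond : β * (α - 1) ≤ 2 * m - 1)
    (hl : 0 ≤ l) {D R ε : ℝ} (hD : 0 ≤ D) (hR : 0 < R) (hε : 0 ≤ ε) :
    ∃ C : ℝ, 0 < C ∧ ∀ b, IsSymbol v (weight β) α b → ∀ ρ r, 1 ≤ ρ → ∀ ξ ξ' : Space d,
      ‖ξ‖ ≤ R * ρ → (1 / 2 ≤ m ∨ (0 < ε ∧ ε * ρ ≤ ‖ξ‖ ∧ 2 * D ≤ ε * ρ)) → ‖ξ' - ξ‖ ≤ D →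
        ‖modelCoeff v m β ι ρ r b 0 ξ' - modelCoeff v m β ι ρ r b 0 ξ‖ ≤
          C * (1 + symbolNorm v (weight β) α l 1 b) * ρ ^ (2 * m - 1) * ‖ξ' - ξ‖ := by
  let c₀ : ℝ := (Real.sqrt (latticeDet v))⁻¹
  have hc₀ : 0 < c₀ := inv_pos.2 (Real.sqrt_pos.2 (latticeDet_pos v))
  let C₁ : ℝ := d * (1 + D) ^ |β * (α - 1)|
  have hC₁ : 0 ≤ C₁ := by positivity
  let C₂ : ℝ := (1 + R + D) ^ (2 * m - 1) + (ε / 2) ^ (2 * m - 1)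
  have hC₂ : 0 < C₂ := by positivity
  refine ⟨2 * m * C₂ + c₀ * C₁ * C₂, by positivity, fun b hb ρ r hρ ξ ξ' hξR hlow hξ => ?_⟩
  have hρ0 : 0 < ρ := one_pos.trans_le hρ
  set B := symbolNorm v (weight β) α l 1 b with hB
  have hB0 : 0 ≤ B := symbolNorm_nonneg _ _
  set δ := ‖ξ' - ξ‖
  have hδ : 0 ≤ δ := norm_nonneg _
  -- lower and upper bounds for the relevant radii
  obtain ⟨lo, hlo, hlolow, hpow⟩ : ∃ lo : ℝ, (0 < lo ∨ (1 ≤ 2 * m ∧ 0 ≤ lo)) ∧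
      lo ≤ max 0 (‖ξ‖ - D) ∧ ∀ z, lo ≤ z → z ≤ (1 + R + D) * ρ →
        z ^ (2 * m - 1) ≤ C₂ * ρ ^ (2 * m - 1) := by
    by_cases hm2 : 1 ≤ 2 * m
    · refine ⟨0, Or.inr ⟨hm2, le_rfl⟩, le_max_left _ _, fun z hz hz' => ?_⟩
      refine (Real.rpow_le_rpow hz hz' (by linarith)).trans ?_
      rw [Real.mul_rpow (by positivity) hρ0.le]
      have : 0 ≤ (ε / 2) ^ (2 * m - 1) := by positivity
      gcongr
      linarith
    · obtain ⟨h1, h2, h3⟩ := hlow.resolve_left (by linarith)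
      refine ⟨ε / 2 * ρ, Or.inl (by positivity), le_max_of_le_right (by linarith),
        fun z hz hz' => ?_⟩
      refine (Real.rpow_le_rpow_of_nonpos (by positivity) hz (by linarith)).trans ?_
      rw [Real.mul_rpow (by positivity) hρ0.le]
      have : 0 ≤ (1 + R + D) ^ (2 * m - 1) := by positivity
      gcongr
      linarith
  have hdist : |‖ξ'‖ - ‖ξ‖| ≤ δ := abs_norm_sub_norm_le _ _
  have hdist' := abs_le.1 (hdist.trans hξ)
  have hDρ : D ≤ D * ρ := le_mul_of_one_le_right hD hρ
  have hmax : ∀ x, 0 ≤ x → ‖ξ‖ - D ≤ x → lo ≤ x := fun x h1 h2 => hlolow.trans (max_le h1 h2)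
  have t1 : |‖ξ'‖ ^ (2 * m) - ‖ξ‖ ^ (2 * m)| ≤ 2 * m * (C₂ * ρ ^ (2 * m - 1)) * δ := by
    refine (abs_rpow_sub_rpow_le (by linarith) hlo hpow ⟨hmax _ (norm_nonneg _) (by linarith), ?_⟩
      ⟨hmax _ (norm_nonneg _) (by linarith), ?_⟩).trans ?_
    · linarith
    · linarith
    · gcongr
  have t2 : ‖symbolO v b ξ' - symbolO v b ξ‖ ≤ c₀ * (C₁ * (B * (C₂ * ρ ^ (2 * m - 1))) * δ) := by
    have h1 := norm_symbolCoeff_sub_le hb hl hξ (zero_mem (dualLattice v))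
    rw [japanese_zero_rpow, mul_one] at h1
    rw [symbolO, symbolO, ← mul_sub, norm_mul, norm_latticeDet_inv]
    refine mul_le_mul_of_nonneg_left (h1.trans ?_) hc₀.le
    have h2 : japanese ξ ^ (β * (α - 1)) ≤ C₂ * ρ ^ (2 * m - 1) :=
      (Real.rpow_le_rpow_of_exponent_le (one_le_japanese ξ) hcond).trans
        (hpow _ (hmax _ (japanese_pos ξ).le (by linarith [norm_le_japanese ξ]))
          (by linarith [japanese_le_one_add_norm ξ]))
    gcongr
  rw [modelCoeff_zero, modelCoeff_zero, add_sub_add_comm, ← Complex.ofReal_sub]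
  refine (norm_add_le _ _).trans ?_
  rw [Complex.norm_real, Real.norm_eq_abs]
  have t3 : 0 ≤ C₂ * ρ ^ (2 * m - 1) * δ := by positivity
  have t4 : 0 ≤ c₀ * C₁ * (C₂ * ρ ^ (2 * m - 1) * δ) := by positivity
  have t5 : 0 ≤ 2 * m * B * (C₂ * ρ ^ (2 * m - 1) * δ) := by positivity
  calc _ ≤ 2 * m * (C₂ * ρ ^ (2 * m - 1)) * δ +
        c₀ * (C₁ * (B * (C₂ * ρ ^ (2 * m - 1))) * δ) := add_le_add t1 t2
    _ ≤ _ := by linarith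

end Model

/-! ### Comparison of the counting functions of two fibres -/

section Comparison

variable {d : ℕ} {m α β κ l : ℝ} {ι : ℝ → ℝ}

/-- Moving the quasi-momentum by `η` (and by any vector of the dual lattice) shifts the eigenvalues
near `t` by at most a constant times `|η| ρ^{2m-1}`, provided that the exponentials with `|ξ| > Rρ`
have energies above `t` and, if `ε > 0`, those with `|ξ| < 2ερ` have energies at most `t`. -/
theorem exists_countingFunction_le (v : Module.Basis (Fin d) ℝ (Space d)) (hm : 0 < m)
    (hβ₁ : β ≤ 1) (hκ : κ < 1) (hcond : β * (α - 1) ≤ 2 * m - 1) (hι : IsCutoff ι)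
    (hl : (d : ℝ) < l) {D R ε : ℝ} (hD : 0 ≤ D) (hR : 2 + D ≤ R) (hε : 0 ≤ ε)
    (hmε : 1 / 2 ≤ m ∨ 0 < ε) :
    ∃ C : ℝ, 0 < C ∧ ∀ b, IsSymbol v (weight β) α b → IsSymmetricSymbol v b →
      ∀ ρ r, 1 ≤ ρ → r ≤ ρ ^ κ → (ε = 0 ∨ (2 * D ≤ ε * ρ ∧ ε ≤ 1 / 8 ∧ r ≤ ρ / 2)) →
      ∀ k η n₀ : Space d, n₀ ∈ dualLattice v → ‖η‖ ≤ D → ∀ t : ℝ,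
        (∀ ξ : Space d, R * ρ < ‖ξ‖ → t < (modelCoeff v m β ι ρ r b 0 ξ).re) →
        (∀ ξ : Space d, ‖ξ‖ < 2 * ε * ρ → (modelCoeff v m β ι ρ r b 0 ξ).re ≤ t) →
        countingFunction (modelFibre v m β ι ρ r b k) t ≤
          countingFunction (modelFibre v m β ι ρ r b (k + η + n₀))
            (t + C * (1 + symbolNorm v (weight β) α l 1 b) * ‖η‖ * ρ ^ (2 * m - 1)) := by
  classical
  have hl0 : 0 ≤ l := (Nat.cast_nonneg d).trans hl.le
  obtain ⟨C₁, hC₁, hoff⟩ := exists_norm_modelCoeff_sub_le v hβ₁ hκ hcond hι hl0 hD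
  obtain ⟨C₂, hC₂, hdiag⟩ := exists_norm_modelCoeff_zero_sub_le v hm hcond hl0 hD
    (by linarith : 0 < R) hε
  obtain ⟨S₀, hS₀, hsum⟩ := exists_sum_japanese_rpow_le v hl
  refine ⟨(C₁ + C₂) * S₀, by positivity,
    fun b hb hsym ρ r hρ hr hερ k η n₀ hn₀ hη t hhigh hlow => ?_⟩
  have hρ0 : 0 < ρ := one_pos.trans_le hρ
  have hrρ : r ≤ ρ := hr.trans (by
    conv_rhs => rw [← Real.rpow_one ρ]
    exact Real.rpow_le_rpow_of_exponent_le hρ hκ.le)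
  set B := symbolNorm v (weight β) α l 1 b with hB
  have hB0 : 0 ≤ B := symbolNorm_nonneg _ _
  set c := modelCoeff v m β ι ρ r b with hc
  have htrig : IsTrigSymbol v (modelSymbol v m β ι ρ r b) c _ := isTrigSymbol_model
  have hDρ : D ≤ D * ρ := le_mul_of_one_le_right hD hρ
  have hRρ : (2 + D) * ρ ≤ R * ρ := by gcongr
  have hsupp := fun {θ ξ : Space d} (h0 : θ ≠ 0) (h : c θ ξ ≠ 0) =>
    norm_of_modelCoeff_ne_zero hι hρ0 h0 h
  let S : Finset (dualLattice v) := (finite_dualLattice_ball v k (R * ρ)).toFinset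
  have hS : ∀ n : dualLattice v, n ∈ S ↔ ‖(n : Space d) + k‖ ≤ R * ρ := fun n =>
    Set.Finite.mem_toFinset _
  have hdec : ∀ n ∉ S, ∀ n' : dualLattice v, n' ≠ n → c (n - n') (n' + k) = 0 := by
    intro n hn n' hne
    by_contra hc0
    refine hn ((hS n).2 ?_)
    obtain ⟨-, -, -, h4⟩ := hsupp (sub_ne_zero.2 fun h => hne (Subtype.ext h.symm)) hc0
    rw [show (n' + k + (n - n') : Space d) = n + k by abel] at h4
    linarith
  have hbig : ∀ n ∉ S, t < (c 0 (n + k)).re := fun n hn =>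
    hhigh _ (not_le.1 fun h => hn ((hS n).2 h))
  have hinv : ∀ n ∉ S, ∀ n' ∈ S, c (n - n') (n' + (k + η)) = 0 := by
    intro n hn n' hn'
    by_contra hc0
    refine hn ((hS n).2 ?_)
    obtain ⟨-, -, -, h4⟩ := hsupp (sub_ne_zero.2 fun h => hn (by rwa [Subtype.ext h])) hc0
    rw [show (n' + (k + η) + (n - n') : Space d) = n + k + η by abel] at h4
    have h5 := norm_sub_norm_le (n + k : Space d) (-η)
    rw [sub_neg_eq_add, norm_neg] at h5
    linarith
  refine (htrig.countingFunction_le _ _ hdec hbig).trans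
    (le_trans ?_ (htrig.le_countingFunction _ _ hn₀ hinv))
  rw [Nat.cast_le]
  -- the indices of low energy
  let s : Set S := {i | ‖((i : dualLattice v) : Space d) + k‖ < ε * ρ}
  have hslow : ∀ i ∈ s, 2 * D ≤ ε * ρ ∧ ε ≤ 1 / 8 ∧ r ≤ ρ / 2 := by
    intro i hi
    refine hερ.resolve_left fun h => ?_
    have : ‖((i : dualLattice v) : Space d) + k‖ < ε * ρ := hi
    rw [h, zero_mul] at this
    exact absurd this (norm_nonneg _).not_gt
  have hdecouple : ∀ τ : Space d, ‖τ‖ ≤ D → ∀ i ∈ s, ∀ j, j ≠ i →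
      fibreMatrix c S (k + τ) i j = 0 ∧ fibreMatrix c S (k + τ) j i = 0 := by
    intro τ hτ i hi j hj
    obtain ⟨h1, h2, h3⟩ := hslow i hi
    have hi' : ‖((i : dualLattice v) : Space d) + k‖ < ε * ρ := hi
    have h4 : ‖((i : dualLattice v) : Space d) + (k + τ)‖ < ρ / 4 := by
      rw [← add_assoc]
      have := norm_add_le (((i : dualLattice v) : Space d) + k) τ
      nlinarith
    have hne : ((i : dualLattice v) : Space d) ≠ ((j : dualLattice v) : Space d) := fun h =>
      hj (Subtype.ext (Subtype.ext h.symm))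
    constructor
    · by_contra hc0
      obtain ⟨-, -, h5, -⟩ := hsupp (sub_ne_zero.2 hne) hc0
      rw [show (((j : dualLattice v) : Space d) + (k + τ) + (((i : dualLattice v) : Space d) -
        ((j : dualLattice v) : Space d))) = ((i : dualLattice v) : Space d) + (k + τ) by abel] at h5
      linarith
    · by_contra hc0
      obtain ⟨h5, -, -, -⟩ := hsupp (sub_ne_zero.2 hne.symm) hc0
      linarith
  set δ := (C₁ + C₂) * S₀ * (1 + B) * ‖η‖ * ρ ^ (2 * m - 1) with hδ
  have hδ0 : 0 ≤ δ := by positivity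
  let g : S → S → ℝ := fun i j => (C₁ + C₂) * (1 + B) * ‖η‖ * ρ ^ (2 * m - 1) *
    japanese (((i : dualLattice v) : Space d) - ((j : dualLattice v) : Space d)) ^ (-l)
  have hjap0 : ∀ θ : Space d, 0 ≤ japanese θ ^ (-l) := fun θ =>
    Real.rpow_nonneg (japanese_pos θ).le _
  refine finrank_lowSpace_le_of_form_le (isHermitian_fibreMatrix_model hsym S k)
    (isHermitian_fibreMatrix_model hsym S (k + η)) (s := s) ?_ (hdecouple η hη) ?_ ?_
  · have := hdecouple 0 (by simpa using hD)
    rwa [add_zero] at this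
  · intro i hi
    obtain ⟨h1, h2, h3⟩ := hslow i hi
    have hi' : ‖((i : dualLattice v) : Space d) + k‖ < ε * ρ := hi
    rw [fibreMatrix, sub_self]
    refine (hlow _ ?_).trans (le_add_of_nonneg_right hδ0)
    rw [← add_assoc]
    have := norm_add_le (((i : dualLattice v) : Space d) + k) η
    linarith
  · refine fun x hx => re_inner_le_add_of_schur (s := s) (g := g) (fun i j => ?_) (fun i j => ?_)
      (fun j => ?_) (fun i hi j hj => ?_) x hx
    · have := hjap0 (((i : dualLattice v) : Space d) - ((j : dualLattice v) : Space d))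
      positivity
    · simp only [g]
      rw [japanese, japanese, norm_sub_rev]
    · simp only [g]
      rw [← Finset.mul_sum]
      let f : S ↪ Space d := ⟨fun i => ((i : dualLattice v) : Space d) -
        ((j : dualLattice v) : Space d), fun a a' h =>
          Subtype.ext (Subtype.ext (sub_left_injective h))⟩
      have h1 := hsum (Finset.univ.map f) fun θ hθ => by
        obtain ⟨i, -, rfl⟩ := Finset.mem_map.1 hθ
        exact sub_mem (i : dualLattice v).2 (j : dualLattice v).2
      rw [Finset.sum_map] at h1
      calc _ ≤ (C₁ + C₂) * (1 + B) * ‖η‖ * ρ ^ (2 * m - 1) * S₀ :=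
            mul_le_mul_of_nonneg_left h1 (by positivity)
        _ = δ := by rw [hδ]; ring
    · have hpos : 0 ≤ ρ ^ (2 * m - 1) * ‖η‖ := by positivity
      have hshift : ((j : dualLattice v) : Space d) + (k + η) -
          (((j : dualLattice v) : Space d) + k) = η := by abel
      rw [fibreMatrix, fibreMatrix]
      by_cases hij : i = j
      · subst hij
        simp only [g]
        rw [sub_self, japanese_zero_rpow, mul_one]
        have hi' : ε * ρ ≤ ‖((i : dualLattice v) : Space d) + k‖ := not_lt.1 hi
        have hlow' : 1 / 2 ≤ m ∨ (0 < ε ∧ ε * ρ ≤ ‖((i : dualLattice v) : Space d) + k‖ ∧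
            2 * D ≤ ε * ρ) := by
          refine hmε.imp id fun h => ⟨h, hi', ?_⟩
          exact (hερ.resolve_left h.ne').1
        have h1 := hdiag b hb ρ r hρ (((i : dualLattice v) : Space d) + k)
          (((i : dualLattice v) : Space d) + (k + η)) ((hS _).1 i.2) hlow' (by rwa [hshift])
        rw [hshift] at h1
        refine h1.trans ?_
        have : 0 ≤ C₁ * (1 + B) * (ρ ^ (2 * m - 1) * ‖η‖) := by positivity
        linarith
      · have h1 := hoff b hb ρ r hρ hr (((i : dualLattice v) : Space d) -
          ((j : dualLattice v) : Space d)) (((j : dualLattice v) : Space d) + k)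
          (((j : dualLattice v) : Space d) + (k + η))
          (sub_ne_zero.2 fun h => hij (Subtype.ext (Subtype.ext h))) (by rwa [hshift])
        rw [hshift] at h1
        refine h1.trans ?_
        have hj0 := hjap0 (((i : dualLattice v) : Space d) - ((j : dualLattice v) : Space d))
        have h2 : C₁ * B * ρ ^ (2 * m - 1) * ‖η‖ ≤
            (C₁ + C₂) * (1 + B) * ‖η‖ * ρ ^ (2 * m - 1) := by
          have : 0 ≤ (C₁ + C₂ + C₂ * B) * (ρ ^ (2 * m - 1) * ‖η‖) := by positivity
          linarith
        exact mul_le_mul_of_nonneg_right h2 hj0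

end Comparison

/-! ### From counting functions to eigenvalues -/

section FromCounting

theorem countingFunction_mono {H : Type*} [NormedAddCommGroup H] [InnerProductSpace ℂ H]
    (T : H →ₗ.[ℂ] H) : Monotone (countingFunction T) := by
  intro s t hst
  refine Cardinal.toENat.monotone' (Submodule.rank_mono ?_)
  exact iSup_le fun μ => le_iSup_of_le (⟨μ, μ.2.trans hst⟩ : Set.Iic t) le_rfl

/-- If the counting functions of `T₀` and `T₁` dominate each other up to a shift by `δ` on the
window `[lo, hi)`, then an eigenvalue of `T₀` inside the window moves by at most `δ`.  Where the
eigenvalue of `T₁` lies above the window, the lower bound for it is trivial. -/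
theorem abs_eigenvalue_sub_le {H : Type*} [NormedAddCommGroup H] [InnerProductSpace ℂ H]
    {T₀ T₁ : H →ₗ.[ℂ] H} {j : ℕ} {lo hi δ : ℝ} (hpos : 0 < eigenvalue T₀ j)
    (hlo : lo + δ < eigenvalue T₀ j) (hδ : 0 ≤ δ) (hhi : eigenvalue T₀ j < hi)
    (h01 : ∀ t, lo ≤ t → t < hi → countingFunction T₀ t ≤ countingFunction T₁ (t + δ))
    (h10 : ∀ t, lo ≤ t → t < hi → countingFunction T₁ t ≤ countingFunction T₀ (t + δ)) :
    |eigenvalue T₁ j - eigenvalue T₀ j| ≤ δ := by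
  let A₀ : Set ℝ := {t : ℝ | (j : ℕ∞) ≤ countingFunction T₀ t}
  let A₁ : Set ℝ := {t : ℝ | (j : ℕ∞) ≤ countingFunction T₁ t}
  have e₀ : eigenvalue T₀ j = sInf A₀ := rfl
  have e₁ : eigenvalue T₁ j = sInf A₁ := rfl
  -- the infimum defining the eigenvalue of `T₀` is not a junk value since it is positive
  have hne : A₀.Nonempty := by
    by_contra h
    rw [e₀, Set.not_nonempty_iff_eq_empty.1 h, Real.sInf_empty] at hpos
    exact hpos.false
  have hbdd : BddBelow A₀ := by
    by_contra h
    rw [e₀, Real.sInf_of_not_bddBelow h] at hpos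
    exact hpos.false
  have hle : ∀ t ∈ A₀, eigenvalue T₀ j ≤ t := fun t ht => csInf_le hbdd ht
  have hmem₀ : ∀ t, eigenvalue T₀ j < t → t ∈ A₀ := by
    intro t ht
    obtain ⟨s, hs, hst⟩ := exists_lt_of_csInf_lt hne ht
    exact le_trans hs (countingFunction_mono T₀ hst.le)
  have hmem₁ : ∀ t, eigenvalue T₀ j < t → t < hi → t + δ ∈ A₁ := by
    intro t ht hti
    exact le_trans (hmem₀ t ht) (h01 t (by linarith) hti)
  have hlow : ∀ t ∈ A₁, lo ≤ t := by
    intro t ht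
    by_contra h
    have h1 : (j : ℕ∞) ≤ countingFunction T₁ lo :=
      le_trans ht (countingFunction_mono T₁ (not_le.1 h).le)
    have := hle _ (h1.trans (h10 lo le_rfl (by linarith)))
    linarith
  have hbdd₁ : BddBelow A₁ := ⟨lo, hlow⟩
  rw [abs_le]
  constructor
  · obtain ⟨t₁, ht₁, ht₁'⟩ := exists_between hhi
    have h1 : eigenvalue T₀ j - δ ≤ sInf A₁ := by
      refine le_csInf ⟨_, hmem₁ t₁ ht₁ ht₁'⟩ fun t ht => ?_
      rcases lt_or_ge t hi with h | h
      · have := hle _ (le_trans ht (h10 t (hlow t ht) h))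
        linarith
      · linarith
    rw [e₁]
    linarith
  · refine sub_le_iff_le_add.2 (le_of_forall_pos_le_add fun x hx => ?_)
    obtain ⟨t, ht, ht'⟩ := exists_between (lt_min hhi (lt_add_of_pos_right (eigenvalue T₀ j) hx))
    have h1 : eigenvalue T₁ j ≤ t + δ := csInf_le hbdd₁ (hmem₁ t ht (ht'.trans_le (min_le_left _ _)))
    have h2 := ht'.trans_le (min_le_right _ _)
    linarith

end FromCounting

/-! ### Estimates in an energy window -/

section Window

variable {d : ℕ} {m α β κ l : ℝ} {ι : ℝ → ℝ}

theorem exists_mul_rpow_le {p q : ℝ} (hpq : p < q) (C : ℝ) :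
    ∃ X : ℝ, 1 ≤ X ∧ ∀ x, X ≤ x → C * x ^ p ≤ x ^ q := by
  obtain ⟨X, hX⟩ := Filter.eventually_atTop.1
    ((tendsto_rpow_atTop (sub_pos.2 hpq)).eventually_ge_atTop C)
  refine ⟨max 1 X, le_max_left _ _, fun x hx => ?_⟩
  have hx0 : 0 < x := one_pos.trans_le ((le_max_left _ _).trans hx)
  have h1 := mul_le_mul_of_nonneg_right (hX x ((le_max_right _ _).trans hx))
    (Real.rpow_nonneg hx0.le p)
  rwa [← Real.rpow_add hx0, sub_add_cancel] at h1

theorem re_modelCoeff_zero (v : Module.Basis (Fin d) ℝ (Space d)) (ρ r : ℝ)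
    (b : Space d → Space d → ℂ) (ξ : Space d) :
    (modelCoeff v m β ι ρ r b 0 ξ).re = ‖ξ‖ ^ (2 * m) + (symbolO v b ξ).re := by
  rw [modelCoeff_zero, Complex.add_re, Complex.ofReal_re]

/-- At high momenta the kinetic energy dominates. -/
theorem exists_half_le_re_modelCoeff_zero (v : Module.Basis (Fin d) ℝ (Space d)) (ι : ℝ → ℝ)
    (hl : 0 ≤ l) (hα : β * α < 2 * m) (K : ℝ) :
    ∃ X : ℝ, 1 ≤ X ∧ ∀ b, IsSymbol v (weight β) α b → symbolNorm v (weight β) α l 1 b ≤ K →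
      ∀ ρ r, ∀ ξ : Space d, X ≤ ‖ξ‖ → ‖ξ‖ ^ (2 * m) / 2 ≤ (modelCoeff v m β ι ρ r b 0 ξ).re := by
  let c₀ : ℝ := (Real.sqrt (latticeDet v))⁻¹
  have hc₀ : 0 < c₀ := inv_pos.2 (Real.sqrt_pos.2 (latticeDet_pos v))
  obtain ⟨X, hX, hpow⟩ := exists_mul_rpow_le hα (2 * (c₀ * (K * (1 ^ (β * α) + 2 ^ (β * α)))))
  refine ⟨X, hX, fun b hb hK ρ r ξ hξ => ?_⟩
  have hξ1 : 1 ≤ ‖ξ‖ := hX.trans hξ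
  have h1 := norm_symbolO_le hb hl ξ
  have h2 : japanese ξ ^ (β * α) ≤ (1 ^ (β * α) + 2 ^ (β * α)) * ‖ξ‖ ^ (β * α) :=
    rpow_le_of_mul_le_of_le_mul one_pos two_pos (by linarith)
      (by linarith [norm_le_japanese ξ]) (by linarith [japanese_le_one_add_norm ξ]) _
  have h3 : symbolNorm v (weight β) α l 1 b * japanese ξ ^ (β * α) ≤
      K * ((1 ^ (β * α) + 2 ^ (β * α)) * ‖ξ‖ ^ (β * α)) :=
    mul_le_mul hK h2 (Real.rpow_nonneg (japanese_pos ξ).le _)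
      ((symbolNorm_nonneg _ _).trans hK)
  have h4 := mul_le_mul_of_nonneg_left h3 hc₀.le
  have h5 := hpow _ hξ
  have h6 := (abs_le.1 ((Complex.abs_re_le_norm (symbolO v b ξ)).trans h1)).1
  rw [re_modelCoeff_zero]
  linarith

/-- For large `ρ` the perturbation at most doubles the bound `cρ^{2m}` for the kinetic energy at
momenta of size at most `sρ`. -/
theorem exists_re_modelCoeff_zero_le (v : Module.Basis (Fin d) ℝ (Space d)) (ι : ℝ → ℝ)
    (hm : 0 < m) (hl : 0 ≤ l) (hα : β * α < 2 * m) {c : ℝ} (hc : 0 < c) (K : ℝ) {s : ℝ}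
    (hs : 0 ≤ s) (hs1 : s ≤ 1) (hsc : s ^ (2 * m) ≤ c) :
    ∃ X : ℝ, 1 ≤ X ∧ ∀ b, IsSymbol v (weight β) α b → symbolNorm v (weight β) α l 1 b ≤ K →
      ∀ ρ r, X ≤ ρ → ∀ ξ : Space d, ‖ξ‖ ≤ s * ρ →
        (modelCoeff v m β ι ρ r b 0 ξ).re ≤ 2 * c * ρ ^ (2 * m) := by
  let c₀ : ℝ := (Real.sqrt (latticeDet v))⁻¹
  have hc₀ : 0 < c₀ := inv_pos.2 (Real.sqrt_pos.2 (latticeDet_pos v))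
  have hm2 : 0 < 2 * m := by linarith
  let p : ℝ := max (β * α) 0
  obtain ⟨X, hX, hpow⟩ := exists_mul_rpow_le (show p < 2 * m from max_lt hα hm2)
    (c₀ * (K * 2 ^ p) / c)
  refine ⟨X, hX, fun b hb hK ρ r hρ ξ hξ => ?_⟩
  have hρ1 : 1 ≤ ρ := hX.trans hρ
  have hξρ : ‖ξ‖ ≤ ρ := hξ.trans (mul_le_of_le_one_left (by linarith) hs1)
  have h1 := norm_symbolO_le hb hl ξ
  have h2 : japanese ξ ^ (β * α) ≤ 2 ^ p * ρ ^ p := by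
    rw [← Real.mul_rpow (by norm_num) (by linarith)]
    refine (Real.rpow_le_rpow_of_exponent_le (one_le_japanese ξ)
      (le_max_left (β * α) 0)).trans ?_
    exact Real.rpow_le_rpow (japanese_pos ξ).le (by linarith [japanese_le_one_add_norm ξ])
      (le_max_right _ _)
  have h3 : symbolNorm v (weight β) α l 1 b * japanese ξ ^ (β * α) ≤ K * (2 ^ p * ρ ^ p) :=
    mul_le_mul hK h2 (Real.rpow_nonneg (japanese_pos ξ).le _)
      ((symbolNorm_nonneg _ _).trans hK)
  have h4 := mul_le_mul_of_nonneg_left h3 hc₀.le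
  have h5 := hpow _ hρ
  rw [div_mul_eq_mul_div, div_le_iff₀ hc] at h5
  have h6 := (abs_le.1 ((Complex.abs_re_le_norm (symbolO v b ξ)).trans h1)).2
  have h7 : ‖ξ‖ ^ (2 * m) ≤ c * ρ ^ (2 * m) := by
    refine (Real.rpow_le_rpow (norm_nonneg _) hξ (by linarith)).trans ?_
    rw [Real.mul_rpow hs (by linarith)]
    gcongr
  rw [re_modelCoeff_zero]
  linarith

theorem torusDist_nonneg (v : Module.Basis (Fin d) ℝ (Space d)) (η : Space d) :
    0 ≤ torusDist v η := Metric.infDist_nonneg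

theorem exists_norm_sub_lt_of_torusDist_lt {v : Module.Basis (Fin d) ℝ (Space d)} {η : Space d}
    {x : ℝ} (h : torusDist v η < x) : ∃ n ∈ dualLattice v, ‖η - n‖ < x := by
  obtain ⟨n, hn, hx⟩ := (Metric.infDist_lt_iff ⟨0, zero_mem (dualLattice v)⟩).1 h
  exact ⟨n, hn, by rwa [← dist_eq_norm]⟩

/-- The Lipschitz estimate for an eigenvalue in a window `(lo, hi)` of energies such that momenta
`|ξ| > Rρ` have energies above the window and, if `ε > 0`, momenta `|ξ| < 2ερ` have energies
below it.  Here `D` bounds the distances to the dual lattice. -/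
theorem exists_abs_floquetEigenvalue_sub_le (v : Module.Basis (Fin d) ℝ (Space d)) (hm : 0 < m)
    (hβ₁ : β ≤ 1) (hκ : κ < 1) (hcond : β * (α - 1) ≤ 2 * m - 1) (hι : IsCutoff ι)
    (hl : (d : ℝ) < l) {D R ε : ℝ} (hD : ∀ η, torusDist v η < D) (hR : 2 + D ≤ R)
    (hε : 0 ≤ ε) (hmε : 1 / 2 ≤ m ∨ 0 < ε) :
    ∃ C : ℝ, 0 < C ∧ ∀ b, IsSymbol v (weight β) α b → IsSymmetricSymbol v b →
      ∀ ρ r, 1 ≤ ρ → r ≤ ρ ^ κ → (ε = 0 ∨ (2 * D ≤ ε * ρ ∧ ε ≤ 1 / 8 ∧ r ≤ ρ / 2)) →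
      ∀ lo hi : ℝ, (∀ ξ : Space d, R * ρ < ‖ξ‖ → hi ≤ (modelCoeff v m β ι ρ r b 0 ξ).re) →
        (∀ ξ : Space d, ‖ξ‖ < 2 * ε * ρ → (modelCoeff v m β ι ρ r b 0 ξ).re ≤ lo) →
      ∀ (j : ℕ) (k η : Space d), 0 < floquetEigenvalue v m β ι ρ r b j k →
        lo + C * (1 + symbolNorm v (weight β) α l 1 b) * D * ρ ^ (2 * m - 1) <
          floquetEigenvalue v m β ι ρ r b j k →
        floquetEigenvalue v m β ι ρ r b j k < hi →
        |floquetEigenvalue v m β ι ρ r b j (k + η) - floquetEigenvalue v m β ι ρ r b j k| ≤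
          C * (1 + symbolNorm v (weight β) α l 1 b) * torusDist v η * ρ ^ (2 * m - 1) := by
  have hD0 : 0 ≤ D := (torusDist_nonneg v 0).trans (hD 0).le
  obtain ⟨C, hC, hcount⟩ := exists_countingFunction_le v hm hβ₁ hκ hcond hι hl hD0 hR hε hmε
  refine ⟨C, hC, fun b hb hsym ρ r hρ hr hερ lo hi hhigh hlow j k η hpos hlo hhi => ?_⟩
  have hcount := hcount b hb hsym ρ r hρ hr hερ
  have hB0 : 0 ≤ symbolNorm v (weight β) α l 1 b := symbolNorm_nonneg _ _
  have hρ0 : 0 < ρ := one_pos.trans_le hρ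
  set M := C * (1 + symbolNorm v (weight β) α l 1 b) * ρ ^ (2 * m - 1) with hM
  have hM0 : 0 < M := by positivity
  have hMx : ∀ x, C * (1 + symbolNorm v (weight β) α l 1 b) * x * ρ ^ (2 * m - 1) = M * x :=
    fun x => by rw [hM]; ring
  rw [hMx] at hlo ⊢
  have key : ∀ x, torusDist v η < x → x < D →
      |floquetEigenvalue v m β ι ρ r b j (k + η) - floquetEigenvalue v m β ι ρ r b j k| ≤
        M * x := by
    intro x hx hxD
    obtain ⟨n, hn, hηn⟩ := exists_norm_sub_lt_of_torusDist_lt hx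
    have hx0 : 0 ≤ x := (norm_nonneg _).trans hηn.le
    have hδ : M * ‖η - n‖ ≤ M * x := by gcongr
    have hxD' : M * x ≤ M * D := by gcongr
    refine abs_eigenvalue_sub_le (lo := lo) (hi := hi) hpos ?_ (by positivity) hhi ?_ ?_
    · exact lt_of_le_of_lt (by linarith) hlo
    · intro t ht1 ht2
      have h1 := hcount k (η - n) n hn (by linarith) t (fun ξ hξ => ht2.trans_le (hhigh ξ hξ))
        (fun ξ hξ => (hlow ξ hξ).trans ht1)
      rw [hMx, show k + (η - n) + n = k + η by abel] at h1
      exact h1.trans (countingFunction_mono _ (by linarith))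
    · intro t ht1 ht2
      have h1 := hcount (k + η) (-(η - n)) (-n) (neg_mem hn) (by rw [norm_neg]; linarith) t
        (fun ξ hξ => ht2.trans_le (hhigh ξ hξ)) (fun ξ hξ => (hlow ξ hξ).trans ht1)
      rw [hMx, norm_neg, show k + η + -(η - n) + -n = k by abel] at h1
      exact h1.trans (countingFunction_mono _ (by linarith))
  by_contra hcon
  rw [not_le, ← lt_div_iff₀' hM0] at hcon
  obtain ⟨x, hx1, hx2⟩ := exists_between (lt_min (hD η) hcon)
  have h1 := key x hx1 (hx2.trans_le (min_le_left _ _))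
  have h2 := hx2.trans_le (min_le_right _ _)
  rw [lt_div_iff₀' hM0] at h2
  linarith

theorem exists_torusDist_lt (v : Module.Basis (Fin d) ℝ (Space d)) :
    ∃ D : ℝ, 0 < D ∧ ∀ η, torusDist v η < D := by
  obtain ⟨D, hD, h⟩ := exists_norm_sub_dualLattice_le v
  refine ⟨D + 1, by linarith, fun η => ?_⟩
  obtain ⟨n, hn, hη⟩ := h η
  have h1 : torusDist v η ≤ dist η n := Metric.infDist_le_dist_of_mem hn
  rw [dist_eq_norm] at h1
  linarith

end Window

end PeriodicPDO

theorem theorem3p5 {d : ℕ} (hd : 1 ≤ d) (v : Module.Basis (Fin d) ℝ (EuclideanSpace ℝ (Fin d)))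
    (m α β κ : ℝ) (hm : 0 < m) (hβ₀ : 0 < β) (hβ₁ : β ≤ 1) (hκ₀ : 0 < κ) (hκβ : κ < β)
    (hcond : β * (α - 1) < 2 * m - 1)
    (ι : ℝ → ℝ) (hι : IsCutoff ι)
    (l : ℝ) (hl : (d : ℝ) < l) (c₁ c₂ : ℝ) (hc₁ : 0 < c₁) (hc₂ : c₁ ≤ c₂) :
    (∃ C : ℝ, 0 < C ∧ ∀ K : ℝ, ∃ ρ₀ : ℝ, 1 ≤ ρ₀ ∧
      ∀ b : EuclideanSpace ℝ (Fin d) → EuclideanSpace ℝ (Fin d) → ℂ,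
        IsSymbol v (weight β) α b → IsSymmetricSymbol v b →
        symbolNorm v (weight β) α l 1 b ≤ K →
        ∀ ρ r : ℝ, ρ₀ ≤ ρ → 1 ≤ r → r ≤ ρ ^ κ →
        ∀ (j : ℕ) (k η : EuclideanSpace ℝ (Fin d)), 1 ≤ j →
          c₁ * ρ ^ (2 * m) ≤ floquetEigenvalue v m β ι ρ r b j k →
          floquetEigenvalue v m β ι ρ r b j k ≤ c₂ * ρ ^ (2 * m) →
          |floquetEigenvalue v m β ι ρ r b j (k + η) - floquetEigenvalue v m β ι ρ r b j k| ≤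
            C * (1 + symbolNorm v (weight β) α l 1 b) * torusDist v η * ρ ^ (2 * m - 1)) ∧
    (1 / 2 ≤ m → ∀ K : ℝ, ∃ C : ℝ, 0 < C ∧
      ∀ b : EuclideanSpace ℝ (Fin d) → EuclideanSpace ℝ (Fin d) → ℂ,
        IsSymbol v (weight β) α b → IsSymmetricSymbol v b →
        symbolNorm v (weight β) α l 1 b ≤ K →
        ∀ ρ r : ℝ, 1 ≤ ρ → 1 ≤ r → r ≤ ρ ^ κ →
        ∀ (j : ℕ) (k η : EuclideanSpace ℝ (Fin d)), 1 ≤ j →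
          c₁ * ρ ^ (2 * m) ≤ floquetEigenvalue v m β ι ρ r b j k →
          floquetEigenvalue v m β ι ρ r b j k ≤ c₂ * ρ ^ (2 * m) →
          |floquetEigenvalue v m β ι ρ r b j (k + η) - floquetEigenvalue v m β ι ρ r b j k| ≤
            C * (1 + symbolNorm v (weight β) α l 1 b) * torusDist v η * ρ ^ (2 * m - 1)) := by
  have hκ1 : κ < 1 := hκβ.trans_le hβ₁
  have hl0 : 0 ≤ l := (Nat.cast_nonneg d).trans hl.le
  have hα : β * α < 2 * m := by linarith
  have hm2 : 0 < 2 * m := by linarith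
  have hc₂0 : 0 < c₂ := hc₁.trans_le hc₂
  obtain ⟨D, hD0, hD⟩ := exists_torusDist_lt v
  -- momenta above `R₀ρ` have kinetic energies above `4c₂ρ^{2m}`
  let R₀ : ℝ := (4 * c₂) ^ (2 * m)⁻¹
  have hR₀ : 0 < R₀ := by positivity
  have hR₀pow : R₀ ^ (2 * m) = 4 * c₂ := by
    rw [← Real.rpow_mul (by positivity), inv_mul_cancel₀ hm2.ne', Real.rpow_one]
  have hbig : ∀ R ρ x : ℝ, R₀ ≤ R → 0 < ρ → R * ρ < x →
      2 * c₂ * ρ ^ (2 * m) ≤ x ^ (2 * m) / 2 := by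
    intro R ρ x hR hρ hx
    have h1 : R₀ * ρ ≤ x := (mul_le_mul_of_nonneg_right hR hρ.le).trans hx.le
    have h2 := Real.rpow_le_rpow (by positivity) h1 hm2.le
    rw [Real.mul_rpow hR₀.le hρ.le, hR₀pow] at h2
    linarith
  refine ⟨?_, fun hmhalf K => ?_⟩
  · -- momenta below `2ερ` have kinetic energies below `c₁ρ^{2m}/4`
    let s : ℝ := min (1 / 4) ((c₁ / 4) ^ (2 * m)⁻¹)
    have hs0 : 0 < s := lt_min (by norm_num) (by positivity)
    have hs4 : s ≤ 1 / 4 := min_le_left _ _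
    have hspow : s ^ (2 * m) ≤ c₁ / 4 := by
      refine (Real.rpow_le_rpow hs0.le (min_le_right _ _) hm2.le).trans_eq ?_
      rw [← Real.rpow_mul (by positivity), inv_mul_cancel₀ hm2.ne', Real.rpow_one]
    obtain ⟨C, hC, hmain⟩ := exists_abs_floquetEigenvalue_sub_le v hm hβ₁ hκ1 hcond.le hι hl hD
      (le_max_left (2 + D) R₀) (by positivity : 0 ≤ s / 2) (Or.inr (by positivity))
    refine ⟨C, hC, fun K => ?_⟩
    obtain ⟨X₁, hX₁, hhigh⟩ := exists_half_le_re_modelCoeff_zero v ι hl0 hα K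
    obtain ⟨X₂, hX₂, hlow⟩ := exists_re_modelCoeff_zero_le v ι hm hl0 hα
      (by positivity : 0 < c₁ / 4) K hs0.le (by linarith) hspow
    obtain ⟨X₃, hX₃, hhalf⟩ := exists_rpow_le_half hκ1
    obtain ⟨X₄, hX₄, hshift⟩ := exists_mul_rpow_le (by linarith : 2 * m - 1 < 2 * m)
      (C * (1 + K) * D * (4 / c₁))
    refine ⟨max X₁ (max X₂ (max X₃ (max X₄ (2 * D / (s / 2))))), hX₁.trans (le_max_left _ _),
      fun b hb hsym hK ρ r hρ _ hr j k η _ hj₁ hj₂ => ?_⟩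
    simp only [max_le_iff] at hρ
    obtain ⟨hρ₁, hρ₂, hρ₃, hρ₄, hρ₅⟩ := hρ
    have hρ1 : 1 ≤ ρ := hX₁.trans hρ₁
    have hρ0 : 0 < ρ := one_pos.trans_le hρ1
    have hρm : 0 < ρ ^ (2 * m) := Real.rpow_pos_of_pos hρ0 _
    refine hmain b hb hsym ρ r hρ1 hr (Or.inr ⟨?_, by linarith, hr.trans (hhalf ρ hρ₃)⟩)
      (2 * (c₁ / 4) * ρ ^ (2 * m)) (2 * c₂ * ρ ^ (2 * m)) (fun ξ hξ => ?_) (fun ξ hξ => ?_)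
      j k η ?_ ?_ ?_
    · rw [div_le_iff₀ (by positivity)] at hρ₅
      linarith
    · refine (hbig _ ρ _ (le_max_right (2 + D) R₀) hρ0 hξ).trans (hhigh b hb hK ρ r ξ ?_)
      have h1 : 1 ≤ max (2 + D) R₀ := le_max_of_le_left (by linarith)
      nlinarith
    · exact hlow b hb hK ρ r hρ₂ ξ (by linarith)
    · exact (mul_pos hc₁ hρm).trans_le hj₁
    · have h1 := hshift ρ hρ₄
      have h2 : C * (1 + symbolNorm v (weight β) α l 1 b) * D * ρ ^ (2 * m - 1) ≤
          C * (1 + K) * D * ρ ^ (2 * m - 1) := by gcongr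
      have h3 : C * (1 + K) * D * ρ ^ (2 * m - 1) ≤ c₁ / 4 * ρ ^ (2 * m) := by
        calc _ = c₁ / 4 * (C * (1 + K) * D * (4 / c₁) * ρ ^ (2 * m - 1)) := by field_simp
          _ ≤ _ := by gcongr
      have h4 : 0 < c₁ * ρ ^ (2 * m) := mul_pos hc₁ hρm
      linarith
    · have := mul_pos hc₂0 hρm
      linarith
  · obtain ⟨X, hX, hhigh⟩ := exists_half_le_re_modelCoeff_zero v ι hl0 hα K
    let R : ℝ := max (2 + D) (max X R₀)
    obtain ⟨C, hC, hmain⟩ := exists_abs_floquetEigenvalue_sub_le v hm hβ₁ hκ1 hcond.le hι hl hD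
      (le_max_left (2 + D) (max X R₀)) le_rfl (Or.inl hmhalf)
    refine ⟨C, hC, fun b hb hsym hK ρ r hρ _ hr j k η _ hj₁ hj₂ => ?_⟩
    have hρ0 : 0 < ρ := one_pos.trans_le hρ
    have hρm : 0 < ρ ^ (2 * m) := Real.rpow_pos_of_pos hρ0 _
    -- no momentum is low here, so the window extends down as far as needed
    refine hmain b hb hsym ρ r hρ hr (Or.inl rfl)
      (floquetEigenvalue v m β ι ρ r b j k -
        C * (1 + symbolNorm v (weight β) α l 1 b) * D * ρ ^ (2 * m - 1) - 1)
      (2 * c₂ * ρ ^ (2 * m)) (fun ξ hξ => ?_) (fun ξ hξ => ?_) j k η ?_ ?_ ?_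
    · refine (hbig _ ρ _ ((le_max_right X R₀).trans (le_max_right _ _)) hρ0 hξ).trans
        (hhigh b hb hK ρ r ξ ?_)
      have h1 : X ≤ R := (le_max_left X R₀).trans (le_max_right _ _)
      have h2 : R ≤ R * ρ := le_mul_of_one_le_right (by linarith) hρ
      exact h1.trans (h2.trans hξ.le)
    · rw [mul_zero, zero_mul] at hξ
      exact absurd hξ (norm_nonneg _).not_gt
    · exact (mul_pos hc₁ hρm).trans_le hj₁
    · linarith
    · have := mul_pos hc₂0 hρm
      linarith
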